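/- **Notation.** $\mathbb D=\{|q|<1\}$, $\mathbb E=\{|q|>1\}$, $\mathbb S^1=\{|q|=1\}$, $\mathbb D_r=\{|z|<r\}$; $\mathcal R$ is the set of roots of unity, $\mathcal R_m=\{\Lambda:\Lambda^m=1\}$, and $\mathcal R_m^*$ is the set of primitive $m$-th roots of unity. For $r>0$, $B_r=zH^\infty(\mathbb D_r)$ is the Banach space of bounded holomorphic functions on $\mathbb D_r$ vanishing at $0$, with the sup norm. For $g=\sum_{n\ge1}g_nz^n\in B_r$, $|q|\neq1$ and $|z|<r$, let $$f_g(q,z)=\sum_{n\ge1}g_n\frac{z^n}{q^n-1},$$ the solution with $f(0)=0$ of $f(qz)-f(z)=g(z)$. Gammel's series is $$G(q)=\sum_{m\ge2}\ \sum_{\Lambda\in\mathcal R_m^*}\frac{e^{-m}}{q-\Lambda},\qquad q\in\mathbb D\cup\mathbb E .$$ *Gevrey spaces.* Let $\lambda\in\mathbb S^1$, $\tau\ge0$ and let $B$ be a Banach space. $\mathcal G_\tau(\lambda,B)$ is the space of $B$-valued functions $f$ for which there are open disks $\Delta^-\subset\mathbb D$, $\Delta^+\subset\mathbb E$ tangent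 to $\mathbb S^1$ at $\lambda$, a series $\sum a_nQ^n\in B[[Q]]$ and $c_0,c_1>0$ such that $f$ is holomorphic in $\Delta=\Delta^-\cup\Delta^+$ and $$\Big\|f(q)-\sum_{n<N}a_n(q-\lambda)^n\Big\|\le c_0c_1^N\,\Gamma(1+\tau N)\,|q-\lambda|^N\qquad(N\ge0,\ q\in\Delta).\tag{$*$}$$ $(q-\lambda)^{-1}\mathcal G_\tau(\lambda,B)$ is the space of functions $f$ with $(q-\lambda)f\in\mathcal G_\tau(\lambda,B)$. $\mathcal G_\tau^{<}(\lambda,B)$ (resp. $\mathcal G_\tau^{>}(\lambda,B)$) is the space of functions that are holomorphic and satisfy $(*)$, with $2\tau$ in place of $\tau$, in the cardioid $\{\lambda(1+ i w^2): |w-\rho|<\rho\}$ (resp. $\{\lambda(1- i w^2): |w-\rho|<\rho\}$) for some $\rho>0$; this cardioid has its cusp at $\lambda$ and its axis tangent to $\mathbb S^1$. *The space $\mathcal G_\tau^\odot$.* Write $\lambda=e^{2\pi i\alpha}$, $\mathbb S^<_\lambda=\{e^{2\pi ix}:\alpha-\frac12<x<\alpha\}$, $\mathbb S^>_\lambda=\{e^{2\pi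 ix}:\alpha<x<\alpha+\frac12\}$ and, for either sign, $$\delta^{\lessgtr}_\lambda(q)(z)=\sum_{n\ge1}\sum_{\ell=0}^{n-1}\delta^{\lessgtr}_{n,\ell}\,q^\ell z^n,\qquad \delta^{\lessgtr}_{n,\ell}=\frac1n\sum_{\Lambda\in\mathcal R_n\cap\mathbb S^{\lessgtr}_\lambda}\Lambda^{-\ell}.$$ With $\odot$ the Hadamard (coefficientwise) product of power series in $z$, $\mathcal G^\odot_\tau(\lambda,B_r)$ is the space of those $f\in\mathcal G_{2\tau}(\lambda,B_r)$ such that $f\odot\delta^<_\lambda$ extends to a function of $\mathcal G^<_\tau(\lambda,B_r)$ and $f\odot\delta^>_\lambda$ extends to a function of $\mathcal G^>_\tau(\lambda,B_r)$. A space of functions is *quasianalytic at* $\lambda$ if each of its members has an asymptotic expansion at $\lambda$, in the sense of one common expansion in two disks tangent to $\mathbb S^1$ at $\lambda$, one in $\mathbb D$ and one in $\mathbb E$ (in powers $(q-\lambda)^{n-1}$, $n\ge0$, for $(q-\lambda)^{-1}\mathcal G_1$), and any two members with the same expansion coincide in all such disks, of radius less than $1$ and of the same radius inside and outside, where both are holomorphic.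 **Theorem 5.1.** Let $A_1=0$ and $A_m=e^{-m}$ for $m\ge2$. There exist $r>1$ and $g\in B_r$, with Taylor coefficients $$g_n=n\sum_{j\ge1}\mu(j)A_{nj}\quad(n\ge1),$$ $\mu$ being the Möbius function, such that the function $$\chi(q,z)=q^{-1}\big(f_g(q,z)-f_g(0,z)\big)$$ (extended by continuity at $q=0$) satisfies $\chi(q,1)=G(q)$ for all $q\in\mathbb D\cup\mathbb E$. Moreover: (i) for every $\Lambda_0\in\mathcal R$, $G$ belongs to $(q-\Lambda_0)^{-1}\mathcal G_1(\Lambda_0,\mathbb C)$, and this space is quasianalytic at $\Lambda_0$; (ii) for every $r'$ with $1<r'<r$, $q\mapsto\chi(q,\cdot)$ is a function from $\mathbb D\cup\mathbb E$ to $B_{r'}$, and for every constant-type point $\lambda$ (that is, $\lambda=e^{2\pi iy}$ with $y$ irrational such that, for some $\gamma>0$, $|y-n/m|\ge\gamma m^{-2}$ for all $n\in\mathbb Z$, $m\ge1$) it belongs to $\mathcal G^\odot_1(\lambda,B_{r'})$, and this space is quasianalytic at $\lambda$. -/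

import Mathlib

open Filter Topology Asymptotics Metric
open scoped BoundedContinuousFunction ArithmeticFunction.Moebius

noncomputable section

namespace Gammel

/-! ### The Banach spaces `z H^∞(𝔻_r)` -/

/-- Extension by `0` to the whole plane of a function on the open disk of radius `r`. -/
def extend {r : ℝ} (φ : ball (0 : ℂ) r →ᵇ ℂ) : ℂ → ℂ :=
  open Classical in fun z => if h : z ∈ ball (0 : ℂ) r then φ ⟨z, h⟩ else 0

theorem extend_of_mem {r : ℝ} (φ : ball (0 : ℂ) r →ᵇ ℂ) {z : ℂ} (h : z ∈ ball (0 : ℂ) r) :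
    extend φ z = φ ⟨z, h⟩ := by
  simp only [extend, dif_pos h]

theorem extend_add {r : ℝ} (φ ψ : ball (0 : ℂ) r →ᵇ ℂ) :
    extend (φ + ψ) = extend φ + extend ψ := by
  funext z
  by_cases h : z ∈ ball (0 : ℂ) r <;> simp only [extend, Pi.add_apply, h, dite_true, dite_false]
  · rfl
  · simp

theorem extend_smul {r : ℝ} (c : ℂ) (φ : ball (0 : ℂ) r →ᵇ ℂ) :
    extend (c • φ) = c • extend φ := by
  funext z
  by_cases h : z ∈ ball (0 : ℂ) r <;> simp only [extend, Pi.smul_apply, h, dite_true, dite_false]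
  · rfl
  · simp

theorem extend_zero {r : ℝ} : extend (0 : ball (0 : ℂ) r →ᵇ ℂ) = 0 := by
  funext z
  by_cases h : z ∈ ball (0 : ℂ) r <;> simp only [extend, Pi.zero_apply, h, dite_true, dite_false]
  rfl

/-- `B_r = z H^∞(𝔻_r)`: the bounded holomorphic functions on the open disk `𝔻_r` that vanish at
the origin, with the supremum norm (the norm is the one of bounded continuous functions). -/
def B (r : ℝ) : Submodule ℂ (ball (0 : ℂ) r →ᵇ ℂ) where
  carrier := {φ | DifferentiableOn ℂ (extend φ) (ball 0 r) ∧ extend φ 0 = 0}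
  add_mem' := by
    rintro φ ψ ⟨h1, h2⟩ ⟨h3, h4⟩
    refine ⟨?_, ?_⟩
    · rw [extend_add]; exact h1.add h3
    · rw [extend_add, Pi.add_apply, h2, h4, add_zero]
  zero_mem' := by
    refine ⟨?_, ?_⟩
    · rw [extend_zero]; exact differentiableOn_const 0
    · rw [extend_zero]; rfl
  smul_mem' := by
    rintro c φ ⟨h1, h2⟩
    refine ⟨?_, ?_⟩
    · rw [extend_smul]; exact h1.const_smul c
    · rw [extend_smul, Pi.smul_apply, h2, smul_zero]

/-- The `n`-th Taylor coefficient at the origin of an element of `B_r`. -/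
def coeff {r : ℝ} (φ : B r) (n : ℕ) : ℂ :=
  iteratedDeriv n (extend (φ : ball (0 : ℂ) r →ᵇ ℂ)) 0 / (n.factorial : ℂ)

/-! ### Solutions of the cohomological equation and Gammel's series -/

/-- `f_g(q, z) = ∑_{n ≥ 1} g_n z^n / (q^n - 1)`, the solution vanishing at `z = 0` of
`f(q z) - f(z) = g(z)`, for `|q| ≠ 1` and `|z| < r`. -/
def solution {r : ℝ} (g : B r) (q z : ℂ) : ℂ :=
  ∑' n : ℕ, coeff g (n + 1) * z ^ (n + 1) / (q ^ (n + 1) - 1)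

/-- `χ(q, z) = q⁻¹ (f_g(q, z) - f_g(0, z))`; the singularity at `q = 0` is removable and the value
there is `∂_q f_g(0, z)`. -/
def chi {r : ℝ} (g : B r) (q z : ℂ) : ℂ :=
  dslope (fun p => solution g p z) 0 q

/-- The coefficients `A_m`: `A_m = e^{-m}` for `m ≥ 2`, and `A_1 = 0`. -/
def gammelCoeff (m : ℕ) : ℂ := if 2 ≤ m then Complex.exp (-(m : ℂ)) else 0

/-- Gammel's series `G(q) = ∑_{m ≥ 2} ∑_{Λ primitive of order m} e^{-m} / (q - Λ)`. -/
def gammelSeries (q : ℂ) : ℂ :=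
  ∑' m : ℕ, ∑ Λ ∈ primitiveRoots m ℂ, gammelCoeff m / (q - Λ)

/-- The set of all roots of unity. -/
def rootsOfUnitySet : Set ℂ := {Λ | ∃ m : ℕ, 1 ≤ m ∧ Λ ^ m = 1}

/-- Real irrational numbers satisfying a Diophantine condition of constant `γ`, exponent `τ`. -/
def DC (γ τ : ℝ) : Set ℝ :=
  {y | Irrational y ∧ ∀ (n : ℤ) (m : ℕ), 1 ≤ m → γ * (m : ℝ) ^ (-τ) ≤ |y - n / m|}

/-- Points `e^{2πiy}` of the unit circle with `y` Diophantine of exponent `τ`; for `τ = 2` these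
are the constant-type points. -/
def diophantinePoints (τ : ℝ) : Set ℂ :=
  {l | ∃ γ : ℝ, 0 < γ ∧ ∃ y ∈ DC γ τ, l = Complex.exp (2 * Real.pi * Complex.I * y)}

/-! ### Gevrey asymptotics and quasianalyticity -/

section Gevrey

variable {E : Type*} [NormedAddCommGroup E] [NormedSpace ℂ E]

/-- The union of the two open disks of radius `ρ` tangent to the unit circle at `l`, one inside
(when `ρ < 1`) and the other outside the unit disk. -/
def tangentDisks (l : ℂ) (ρ : ℝ) : Set ℂ :=
  ball ((1 - ρ) * l) ρ ∪ ball ((1 + ρ) * l) ρ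

/-- `f` is holomorphic in `s` and has there the Gevrey-`τ` asymptotic expansion
`∑ a_n (q - l)^n`. -/
def HasGevreyExpansionOn (τ : ℝ) (l : ℂ) (s : Set ℂ) (f : ℂ → E) (a : ℕ → E) : Prop :=
  DifferentiableOn ℂ f s ∧ ∃ c₀ : ℝ, 0 < c₀ ∧ ∃ c₁ : ℝ, 0 < c₁ ∧ ∀ N : ℕ, ∀ q ∈ s,
    ‖f q - ∑ n ∈ Finset.range N, (q - l) ^ n • a n‖ ≤
      c₀ * c₁ ^ N * Real.Gamma (1 + N * τ) * ‖q - l‖ ^ N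

/-- The Gevrey class `𝒢_τ(l, E)`: functions having one and the same Gevrey-`τ` expansion at `l`
in two disks tangent to the unit circle at `l`, one inside and one outside. -/
def gevreyClass (τ : ℝ) (l : ℂ) (E : Type*) [NormedAddCommGroup E] [NormedSpace ℂ E] :
    Set (ℂ → E) :=
  {f | ∃ ρ ∈ Set.Ioo (0 : ℝ) 1, ∃ a : ℕ → E, HasGevreyExpansionOn τ l (tangentDisks l ρ) f a}

/-- The space `(q - l)⁻¹ 𝒢_τ(l, E)`. -/
def poleGevreyClass (τ : ℝ) (l : ℂ) (E : Type*) [NormedAddCommGroup E] [NormedSpace ℂ E] :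
    Set (ℂ → E) :=
  {f | (fun q => (q - l) • f q) ∈ gevreyClass τ l E}

/-- `f(q) ∼ ∑_{n ≥ 0} a_n (q - l)^{n - k}` as `q` tends to `l` in two disks tangent to the unit
circle at `l`, one inside and one outside (`k = 0`: Taylor type, `k = 1`: at most a
simple pole). -/
def HasAsymptoticExpansion (l : ℂ) (k : ℕ) (f : ℂ → E) (a : ℕ → E) : Prop :=
  ∃ ρ ∈ Set.Ioo (0 : ℝ) 1, ∀ N : ℕ,
    (fun q => f q - ∑ n ∈ Finset.range N, (q - l) ^ ((n : ℤ) - k) • a n)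
      =O[𝓝[tangentDisks l ρ] l] (fun q => (q - l) ^ ((N : ℤ) - k))

/-- Quasianalyticity at `l` of a space `S` of functions: every member has an asymptotic expansion
at `l`, and two members with the same expansion coincide (in all tangent disks where
both are holomorphic). -/
def IsQuasianalyticAt (l : ℂ) (k : ℕ) (S : Set (ℂ → E)) : Prop :=
  (∀ f ∈ S, ∃ a : ℕ → E, HasAsymptoticExpansion l k f a) ∧
  ∀ f₁ ∈ S, ∀ f₂ ∈ S, ∀ a : ℕ → E,
    HasAsymptoticExpansion l k f₁ a → HasAsymptoticExpansion l k f₂ a →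
    ∀ ρ ∈ Set.Ioo (0 : ℝ) 1, DifferentiableOn ℂ f₁ (tangentDisks l ρ) →
      DifferentiableOn ℂ f₂ (tangentDisks l ρ) → Set.EqOn f₁ f₂ (tangentDisks l ρ)

/-! ### Cardioids, and the quasianalytic space at constant-type points -/

/-- The half circle of points `e^{2πix}` with `α - 1/2 < x < α`, where `l = e^{2πiα}`. -/
def arcLT (l : ℂ) : Set ℂ :=
  {w | ∃ t ∈ Set.Ioo (-(1 / 2) : ℝ) 0, w = l * Complex.exp (2 * Real.pi * Complex.I * t)}

/-- The half circle of points `e^{2πix}` with `α < x < α + 1/2`, where `l = e^{2πiα}`. -/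
def arcGT (l : ℂ) : Set ℂ :=
  {w | ∃ t ∈ Set.Ioo (0 : ℝ) (1 / 2), w = l * Complex.exp (2 * Real.pi * Complex.I * t)}

/-- The interior of a cardioid with cusp at `l` and axis tangent to the unit circle at `l`. Its
axis points towards `arcGT l`; when it is small it does not meet `arcLT l`. -/
def cardioidLT (l : ℂ) (ρ : ℝ) : Set ℂ :=
  (fun u : ℂ => l * (1 + Complex.I * (u - 1) ^ 2)) '' ball (1 + ρ : ℂ) ρ

/-- The interior of the cardioid symmetric to the previous one. Its axis points towards
`arcLT l`; when it is small it does not meet `arcGT l`. -/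
def cardioidGT (l : ℂ) (ρ : ℝ) : Set ℂ :=
  (fun u : ℂ => l * (1 - Complex.I * (u - 1) ^ 2)) '' ball (1 + ρ : ℂ) ρ

/-- `𝒢_τ^<(l, E)`: functions with a Gevrey-`2τ` expansion at `l` in a cardioid of the
first kind. -/
def gevreyLT (τ : ℝ) (l : ℂ) (E : Type*) [NormedAddCommGroup E] [NormedSpace ℂ E] :
    Set (ℂ → E) :=
  {f | ∃ ρ : ℝ, 0 < ρ ∧ ∃ a : ℕ → E, HasGevreyExpansionOn (2 * τ) l (cardioidLT l ρ) f a}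

/-- `𝒢_τ^>(l, E)`: functions with a Gevrey-`2τ` expansion at `l` in a cardioid of the
second kind. -/
def gevreyGT (τ : ℝ) (l : ℂ) (E : Type*) [NormedAddCommGroup E] [NormedSpace ℂ E] :
    Set (ℂ → E) :=
  {f | ∃ ρ : ℝ, 0 < ρ ∧ ∃ a : ℕ → E, HasGevreyExpansionOn (2 * τ) l (cardioidGT l ρ) f a}

end Gevrey

/-- For a subset `S` of the circle, the coefficient of `z^n` (`n ≥ 1`) in the series
`∑_{ℓ ≥ 0, n ≥ ℓ + 1} δ_{n,ℓ} q^ℓ z^n`, where `δ_{n,ℓ} = (1/n) ∑_{Λ^n = 1, Λ ∈ S} Λ^{-ℓ}`. For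
`S = arcLT l` or `S = arcGT l` these are the coefficients of `δ_l^<(q)` or `δ_l^>(q)`. -/
def deltaCoeff (S : Set ℂ) (n : ℕ) (q : ℂ) : ℂ :=
  open Classical in
  ∑ ℓ ∈ Finset.range n,
    ((1 / (n : ℂ)) * ∑ Λ ∈ (Polynomial.nthRootsFinset n (1 : ℂ)).filter (· ∈ S), (Λ ^ ℓ)⁻¹) * q ^ ℓ

/-- `𝒢_τ^⊙(l, B_r)`: the functions `f` in `𝒢_{2τ}(l, B_r)` such that the Hadamard product (in `z`)
`f ⊙ δ_l^<` extends to a function of `𝒢_τ^<(l, B_r)` and `f ⊙ δ_l^>` extends to a function of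
`𝒢_τ^>(l, B_r)`. -/
def hadamardGevreyClass (τ : ℝ) (l : ℂ) (r : ℝ) : Set (ℂ → B r) :=
  {f | f ∈ gevreyClass (2 * τ) l (B r) ∧
    (∃ h ∈ gevreyLT τ l (B r), ∃ ρ ∈ Set.Ioo (0 : ℝ) 1,
      ∀ q ∈ tangentDisks l ρ ∩ cardioidLT l ρ, ∀ n : ℕ,
        coeff (h q) n = coeff (f q) n * deltaCoeff (arcLT l) n q) ∧
    (∃ h ∈ gevreyGT τ l (B r), ∃ ρ ∈ Set.Ioo (0 : ℝ) 1,
      ∀ q ∈ tangentDisks l ρ ∩ cardioidGT l ρ, ∀ n : ℕ,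
        coeff (h q) n = coeff (f q) n * deltaCoeff (arcGT l) n q)}

end Gammel

end

noncomputable section

namespace Gammel

/-! ### The Banach space `B r` -/

/-! Put `R_n = ∑ μ(j) A_{nj}` (`residue`), so that `g_n = n R_n`. Since `q⁻¹ (1/(q^n - 1) + 1) =
q^(n-1)/(q^n - 1)` and `n q^(n-1)/(q^n - 1)` is the logarithmic derivative of `q^n - 1`, `χ(q, z) =
∑ R_n z^n ∑_{Λ^n = 1} 1/(q - Λ)`. At `z = 1`, collecting the roots of exact order `a` gives the
weight `∑_b R_{ab}`, which is `A_a` by Möbius inversion (`tsum_residue_poles_eq_gammelSeries`).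

All Gevrey expansions come from `hasGevreyExpansionOn_poles`. Expanding `1/(q - Λ)` geometrically at
`l` leaves the remainder `(q - l)^N (-1)^N (l - Λ)^(-N) / (q - Λ)`. If `|l - Λ| ≥ κ n^(-σ)` and `|q
- Λ| ≥ c |l - Λ|^2`, summation against weights `O(e^(-n/2))` yields moments of size `C^N (σN)!`. A
root of unity has `σ = 1` once its own pole is set aside; a constant-type point has `σ = 2`. The
quadratic separation holds in tangent disks, and in a cardioid for the roots on the opposite half
circle.

Gevrey-1 flatness in a disk with `l` on its boundary forces vanishing (Watson, by Phragmén–Lindelöf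
in the variable `1/w`), whence quasianalyticity at roots of unity. Gevrey-2 flatness in such a disk
does not suffice; in a cardioid it does, since `w ↦ w^2` pulls it back to Gevrey-1 flatness in a
disk. Hadamard multiplication by `δ^<` or `δ^>` retains only the poles on one half circle, up to a
part holomorphic near `l`, so the product extends to a cardioid (`exists_hadamard_extension`). The
multiplier belonging to the half circle that contains `1` has coefficients that are nonzero
polynomials in `q`, so it can be divided out by the identity theorem (`eqOn_of_hadamard_gevrey`). -/

theorem norm_extend_le {r : ℝ} (φ : ball (0 : ℂ) r →ᵇ ℂ) (z : ℂ) : ‖extend φ z‖ ≤ ‖φ‖ := by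
  by_cases h : z ∈ ball (0 : ℂ) r
  · rw [extend_of_mem φ h]; exact φ.norm_coe_le_norm _
  · simp only [extend, h, dite_false, norm_zero]; exact norm_nonneg _

theorem extend_sub {r : ℝ} (φ ψ : ball (0 : ℂ) r →ᵇ ℂ) :
    extend (φ - ψ) = extend φ - extend ψ := by
  have h := extend_add (φ - ψ) ψ
  rw [sub_add_cancel] at h
  rw [h, add_sub_cancel_right]

/-- Uniform limits of holomorphic functions are holomorphic. The resulting completeness of `B r`
allows series to be summed in it. -/
theorem isClosed_B (r : ℝ) : IsClosed (B r : Set (ball (0 : ℂ) r →ᵇ ℂ)) := by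
  apply IsSeqClosed.isClosed
  intro u φ hu hφ
  have key : ∀ n z, ‖extend φ z - extend (u n) z‖ ≤ ‖φ - u n‖ := by
    intro n z
    rw [← Pi.sub_apply, ← extend_sub]
    exact norm_extend_le _ _
  have h0 : Tendsto (fun n => ‖φ - u n‖) atTop (𝓝 0) := by
    have := (tendsto_const_nhds (x := φ)).sub hφ
    simpa using this.norm
  have hunif : TendstoUniformly (fun n => extend (u n)) (extend φ) atTop := by
    rw [Metric.tendstoUniformly_iff]
    intro ε hε
    filter_upwards [h0.eventually (gt_mem_nhds hε)] with n hn z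
    rw [dist_eq_norm]
    exact (key n z).trans_lt hn
  refine ⟨?_, ?_⟩
  · exact (hunif.tendstoUniformlyOn.tendstoLocallyUniformlyOn (s := ball 0 r)).differentiableOn
      (Eventually.of_forall fun n => (hu n).1) isOpen_ball
  · refine tendsto_nhds_unique (hunif.tendsto_at 0) ?_
    simp only [fun n => (hu n).2]
    exact tendsto_const_nhds

instance completeSpace_B (r : ℝ) : CompleteSpace (B r) :=
  (isClosed_B r).completeSpace_coe

theorem contDiffAt_extend {r : ℝ} (hr : 0 < r) (φ : B r) (n : ℕ) :
    ContDiffAt ℂ n (extend (φ : ball (0 : ℂ) r →ᵇ ℂ)) 0 :=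
  (φ.2.1.analyticAt (ball_mem_nhds 0 hr)).contDiffAt

/-- Cauchy's estimate on the circle of radius `r / 2`. Continuity of the coefficient functionals
lets them pass through infinite sums and Gevrey expansions. -/
theorem norm_coeff_le {r : ℝ} (hr : 0 < r) (φ : B r) (n : ℕ) :
    ‖coeff φ n‖ ≤ (1 / (r / 2) ^ n) * ‖φ‖ := by
  have hd : DiffContOnCl ℂ (extend (φ : ball (0 : ℂ) r →ᵇ ℂ)) (ball 0 (r / 2)) := by
    apply DifferentiableOn.diffContOnCl
    refine φ.2.1.mono ?_
    rw [closure_ball _ (by positivity)]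
    exact closedBall_subset_ball (by linarith)
  have h := Complex.norm_iteratedDeriv_le_of_forall_mem_sphere_norm_le n (by positivity) hd
    (fun z _ => norm_extend_le (φ : ball (0 : ℂ) r →ᵇ ℂ) z)
  rw [coeff, norm_div, Complex.norm_natCast, div_le_iff₀ (by positivity)]
  calc _ ≤ _ := h
    _ = _ := by rw [Submodule.coe_norm]; ring

/-- The `n`-th Taylor coefficient as a continuous linear functional. -/
def coeffCLM {r : ℝ} (hr : 0 < r) (n : ℕ) : B r →L[ℂ] ℂ :=
  LinearMap.mkContinuous
    { toFun := fun φ => coeff φ n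
      map_add' := fun φ ψ => by
        simp only [coeff, Submodule.coe_add, extend_add]
        rw [iteratedDeriv_add (contDiffAt_extend hr φ n) (contDiffAt_extend hr ψ n), add_div]
      map_smul' := fun c φ => by
        simp only [coeff, Submodule.coe_smul, extend_smul, RingHom.id_apply]
        rw [iteratedDeriv_const_smul (contDiffAt_extend hr φ n) c, smul_eq_mul, smul_eq_mul,
          mul_div_assoc] }
    (1 / (r / 2) ^ n) (norm_coeff_le hr · n)

@[simp] theorem coeffCLM_apply {r : ℝ} (hr : 0 < r) (n : ℕ) (φ : B r) :
    coeffCLM hr n φ = coeff φ n := rfl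

/-- Evaluation at a point of the disk. -/
def evalCLM {r : ℝ} (z : ball (0 : ℂ) r) : B r →L[ℂ] ℂ :=
  (BoundedContinuousFunction.evalCLM ℂ z).comp (B r).subtypeL

@[simp] theorem evalCLM_apply {r : ℝ} (z : ball (0 : ℂ) r) (φ : B r) :
    evalCLM z φ = (φ : ball (0 : ℂ) r →ᵇ ℂ) z := rfl

theorem coeff_zero_right {r : ℝ} (φ : B r) : coeff φ 0 = 0 := by
  simp [coeff, φ.2.2]

theorem eq_of_coeff_eq {r : ℝ} {φ ψ : B r} (h : ∀ n, coeff φ n = coeff ψ n) : φ = ψ := by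
  ext z
  have h1 := Complex.hasSum_taylorSeries_on_ball φ.2.1 z.2
  have h2 := Complex.hasSum_taylorSeries_on_ball ψ.2.1 z.2
  rw [extend_of_mem _ z.2] at h1 h2
  refine h1.unique ?_
  convert h2 using 2 with n
  have hn := h n
  have hf : (n.factorial : ℂ) ≠ 0 := by exact_mod_cast n.factorial_ne_zero
  rw [coeff, coeff, div_left_inj' hf] at hn
  rw [hn]

/-- The monomial `z^(n+1)` as an element of `B r`. -/
def monomial (r : ℝ) (n : ℕ) : B r :=
  ⟨BoundedContinuousFunction.ofNormedAddCommGroup (fun z : ball (0 : ℂ) r => (z : ℂ) ^ (n + 1))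
    (by fun_prop) (r ^ (n + 1)) (fun z => by
      rw [norm_pow]
      exact pow_le_pow_left₀ (norm_nonneg _) (mem_ball_zero_iff.1 z.2).le _), by
    constructor
    · refine (differentiable_pow (𝕜 := ℂ) (n + 1)).differentiableOn.congr fun z hz => ?_
      rw [extend_of_mem _ hz]; rfl
    · by_cases h : (0 : ℂ) ∈ ball (0 : ℂ) r
      · rw [extend_of_mem _ h]
        exact zero_pow n.succ_ne_zero
      · simp only [extend, h, dite_false]⟩

theorem monomial_apply (r : ℝ) (n : ℕ) (z : ball (0 : ℂ) r) :
    (monomial r n : ball (0 : ℂ) r →ᵇ ℂ) z = (z : ℂ) ^ (n + 1) := rfl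

theorem norm_monomial_le {r : ℝ} (hr : 0 ≤ r) (n : ℕ) : ‖monomial r n‖ ≤ r ^ (n + 1) := by
  rw [Submodule.coe_norm]
  refine (BoundedContinuousFunction.norm_le (by positivity)).2 fun z => ?_
  rw [monomial_apply, norm_pow]
  exact pow_le_pow_left₀ (norm_nonneg _) (mem_ball_zero_iff.1 z.2).le _

theorem coeff_monomial {r : ℝ} (hr : 0 < r) (k n : ℕ) :
    coeff (monomial r k) n = if n = k + 1 then 1 else 0 := by
  have h : extend (monomial r k : ball (0 : ℂ) r →ᵇ ℂ) =ᶠ[𝓝 0] fun z => z ^ (k + 1) := by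
    filter_upwards [ball_mem_nhds (0 : ℂ) hr] with z hz
    rw [extend_of_mem _ hz]; rfl
  rw [coeff, h.iteratedDeriv_eq, iteratedDeriv_pow]
  split_ifs with hn
  · subst hn
    rw [Nat.descFactorial_self, Nat.sub_self, pow_zero, mul_one, div_self]
    exact_mod_cast Nat.factorial_ne_zero _
  · rcases lt_or_gt_of_ne hn with hn | hn
    · rw [zero_pow (by omega), mul_zero, zero_div]
    · rw [Nat.descFactorial_of_lt hn]; simp

theorem coeff_tsum_smul_monomial {r : ℝ} (hr : 0 < r) {c : ℕ → ℂ} (hc : Summable fun n => c n • monomial r n)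
    (n : ℕ) : coeff (∑' k, c k • monomial r k) (n + 1) = c n := by
  rw [← coeffCLM_apply hr, (coeffCLM hr (n + 1)).map_tsum hc]
  simp only [map_smul, coeffCLM_apply, coeff_monomial hr, smul_eq_mul]
  rw [tsum_eq_single n]
  · simp
  · intro k hk
    rw [if_neg (by omega), mul_zero]

/-! ### Watson's uniqueness lemma -/

theorem mem_ball_self_iff {s : ℝ} (hs : 0 < s) (w : ℂ) :
    w ∈ ball (s : ℂ) s ↔ Complex.normSq w < 2 * s * w.re := by
  rw [mem_ball, Complex.dist_eq, ← sq_lt_sq₀ (norm_nonneg _) hs.le, Complex.sq_norm,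
    Complex.normSq_apply, Complex.normSq_apply]
  simp only [Complex.sub_re, Complex.ofReal_re, Complex.sub_im, Complex.ofReal_im, sub_zero]
  constructor <;> intro h <;> nlinarith

theorem ne_zero_of_mem_ball_self {s : ℝ} {w : ℂ} (h : w ∈ ball (s : ℂ) s) : w ≠ 0 := by
  rintro rfl
  have := mem_ball.1 h
  rw [Complex.dist_eq, zero_sub, norm_neg, Complex.norm_real, Real.norm_eq_abs] at this
  exact absurd (le_abs_self s) (not_le.2 this)

/-- Instead of optimising over `N`, all the bounds are summed: with `y = 1/(2KW)` each gives `x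
y^(2N)/(2N)! ≤ c₀ 4^(-N)`, hence `x cosh y ≤ (4/3) c₀`. Even exponents suffice, and they serve both
Gevrey-1 bounds in disks and Gevrey-2 bounds in cardioids. -/
theorem exp_decay_of_flat {x c₀ c₁ K W : ℝ} (hK : 0 < K) (hc : c₁ ≤ K ^ 2) (hc₀ : 0 ≤ c₀)
    (hc₁ : 0 ≤ c₁) (hW : 0 < W) (hx : 0 ≤ x)
    (h : ∀ N : ℕ, x ≤ c₀ * c₁ ^ N * (2 * N).factorial * W ^ (2 * N)) :
    x ≤ 4 * c₀ * Real.exp (-(1 / (2 * K)) / W) := by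
  set y : ℝ := (1 / (2 * K)) / W with hy
  have hy0 : 0 < y := by positivity
  have h1 : ∀ N : ℕ, x * (y ^ (2 * N) / (2 * N).factorial) ≤ c₀ * (1 / 4) ^ N := by
    intro N
    have h2 : c₁ ^ N ≤ (K ^ 2) ^ N := pow_le_pow_left₀ hc₁ hc N
    calc x * (y ^ (2 * N) / (2 * N).factorial)
        ≤ (c₀ * c₁ ^ N * (2 * N).factorial * W ^ (2 * N)) * (y ^ (2 * N) / (2 * N).factorial) := by
          gcongr; exact h N
      _ = c₀ * c₁ ^ N * (W * y) ^ (2 * N) := by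
          have : ((2 * N).factorial : ℝ) ≠ 0 := by positivity
          rw [mul_pow]; field_simp
      _ ≤ c₀ * (K ^ 2) ^ N * (W * y) ^ (2 * N) := by gcongr
      _ = c₀ * (1 / 4) ^ N := by
          have : W * y = 1 / (2 * K) := by rw [hy]; field_simp
          rw [this, pow_mul, mul_assoc, ← mul_pow]
          congr 2
          field_simp; norm_num
  have h2 := (Real.hasSum_cosh y).mul_left x
  have h3 := (hasSum_geometric_of_lt_one (r := (1 / 4 : ℝ)) (by norm_num) (by norm_num)).mul_left c₀
  have h4 := hasSum_le h1 h2 h3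
  have h5 : Real.exp y / 2 ≤ Real.cosh y := by
    rw [Real.cosh_eq]; linarith [Real.exp_pos (-y)]
  have h6 : x * (Real.exp y / 2) ≤ 2 * c₀ := by
    calc _ ≤ x * Real.cosh y := by gcongr
      _ ≤ _ := h4
      _ ≤ _ := by norm_num; linarith
  have : -(1 / (2 * K)) / W = -y := by rw [hy]; ring
  rw [this, Real.exp_neg, ← div_eq_mul_inv, le_div_iff₀ (Real.exp_pos _)]
  linarith

theorem norm_exp_neg_mul_log_le {b : ℝ} (hb : 0 ≤ b) {ξ : ℂ} (hξ : 0 ≤ ξ.re) :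
    ‖Complex.exp (-(b * (ξ * Complex.log ξ)))‖ ≤
      Real.exp (2 * b * ‖ξ‖ - b * (ξ.re * Real.log ‖ξ‖)) := by
  rw [Complex.norm_exp]
  apply Real.exp_le_exp.2
  rw [Complex.neg_re, Complex.re_ofReal_mul, Complex.mul_re, Complex.log_re, Complex.log_im]
  -- In the closed right half-plane `|arg ξ| ≤ π/2 ≤ 2`.
  have h1 : ξ.im * ξ.arg ≤ ‖ξ‖ * 2 := by
    calc ξ.im * ξ.arg ≤ |ξ.im * ξ.arg| := le_abs_self _
      _ = |ξ.im| * |ξ.arg| := abs_mul _ _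
      _ ≤ ‖ξ‖ * 2 := by
        gcongr
        · exact Complex.abs_im_le_norm ξ
        · have := Complex.abs_arg_le_pi_div_two_iff.2 hξ
          linarith [Real.pi_lt_four]
  nlinarith

/-- A holomorphic function in a disk whose boundary contains the origin vanishes identically when
it decays exponentially in the inverse of the distance to the origin. -/
theorem eqOn_zero_of_exp_decay {ρ C c : ℝ} (hρ : 0 < ρ) (hc : 0 < c) {F : ℂ → ℂ}
    (hF : DifferentiableOn ℂ F (ball (ρ : ℂ) ρ))
    (h : ∀ w ∈ ball (ρ : ℂ) ρ, ‖F w‖ ≤ C * Real.exp (-c / ‖w‖)) :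
    Set.EqOn F 0 (ball (ρ : ℂ) ρ) := by
  -- In the variable `ξ = 1/w` the disk becomes the half-plane `Re ξ > 1/(2ρ)`. Taking `R ≥ 1/ρ`
  -- places `Re ξ ≥ R` inside it, and `R ≥ 1` keeps `log |ξ|` nonnegative.
  set R : ℝ := max (1 / ρ) 1 with hR
  have hR1 : 1 ≤ R := le_max_right _ _
  have hRρ : 1 ≤ R * ρ := by
    have : 1 / ρ ≤ R := le_max_left _ _
    rwa [div_le_iff₀ hρ] at this
  have hC : 0 ≤ C := by
    have := (norm_nonneg _).trans (h ρ (mem_ball_self hρ))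
    exact nonneg_of_mul_nonneg_left this (Real.exp_pos _)
  have hmem : ∀ ξ : ℂ, R ≤ ξ.re → ξ⁻¹ ∈ ball (ρ : ℂ) ρ := by
    intro ξ hξ
    have hpos : 0 < Complex.normSq ξ := by
      apply Complex.normSq_pos.2
      rintro rfl
      simp at hξ; linarith
    rw [mem_ball_self_iff hρ, Complex.normSq_inv, Complex.inv_re, inv_eq_one_div, ← mul_div_assoc]
    gcongr
    nlinarith
  -- The factor `exp(-(c/2) ξ log ξ)` costs at most `e^(c|ξ|)`, exactly what the decay of `F` pays
  -- for. So `f` is bounded on the half-plane and decays faster than any exponential on the positive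
  -- axis, as Phragmén–Lindelöf requires.
  set f : ℂ → ℂ := fun x =>
    F ((x + R)⁻¹) * Complex.exp (-((c / 2 : ℝ) * ((x + R) * Complex.log (x + R)))) with hf
  have hre : ∀ x : ℂ, 0 ≤ x.re → R ≤ (x + R).re := by
    intro x hx; simpa using hx
  have hnorm : ∀ x : ℂ, 0 ≤ x.re → 1 ≤ ‖x + R‖ := fun x hx =>
    (hR1.trans (hre x hx)).trans ((le_abs_self _).trans (Complex.abs_re_le_norm _))
  have hbound : ∀ x : ℂ, 0 ≤ x.re →
      ‖f x‖ ≤ C * Real.exp (-(c / 2 * ((x + R).re * Real.log ‖x + R‖))) := by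
    intro x hx
    have h1 := h _ (hmem _ (hre x hx))
    have h2 := norm_exp_neg_mul_log_le (b := c / 2) (by positivity) (ξ := x + R)
      (by linarith [hre x hx])
    rw [norm_inv, div_inv_eq_mul] at h1
    rw [hf, norm_mul]
    calc _ ≤ (C * Real.exp (-c * ‖x + R‖)) * _ :=
          mul_le_mul h1 h2 (norm_nonneg _) (by positivity)
      _ = _ := by rw [mul_assoc, ← Real.exp_add]; ring_nf
  have hbound' : ∀ x : ℂ, 0 ≤ x.re → ‖f x‖ ≤ C := by
    intro x hx
    refine (hbound x hx).trans ?_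
    have h1 : 0 ≤ Real.log ‖x + R‖ := Real.log_nonneg (hnorm x hx)
    have h2 : 0 ≤ (x + R).re := by linarith [hre x hx]
    have : Real.exp (-(c / 2 * ((x + R).re * Real.log ‖x + R‖))) ≤ 1 := by
      apply Real.exp_le_one_iff.2
      have : 0 ≤ c / 2 * ((x + R).re * Real.log ‖x + R‖) := by positivity
      linarith
    calc _ ≤ C * 1 := by gcongr
      _ = C := mul_one C
  have hzero : Set.EqOn f 0 {z : ℂ | 0 ≤ z.re} := by
    apply PhragmenLindelof.eq_zero_on_right_half_plane_of_superexponential_decay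
    · apply DifferentiableOn.diffContOnCl
      have hcl : closure {z : ℂ | 0 < z.re} = {z : ℂ | 0 ≤ z.re} := by
        simp
      rw [hcl]
      intro x hx
      have h1 := hre x hx
      have hne : x + R ≠ 0 := by
        intro h0; rw [h0] at h1; simp at h1; linarith
      have hslit : x + R ∈ Complex.slitPlane := Or.inl (by linarith)
      have hd : DifferentiableAt ℂ F ((x + R)⁻¹) :=
        hF.differentiableAt (isOpen_ball.mem_nhds (hmem _ h1))
      apply DifferentiableAt.differentiableWithinAt
      apply DifferentiableAt.mul
      · exact DifferentiableAt.comp x hd ((differentiableAt_id.add_const _).inv hne)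
      · have : DifferentiableAt ℂ (fun x : ℂ => Complex.log (x + R)) x :=
          (differentiableAt_id.add_const _).clog hslit
        fun_prop
    · refine ⟨1, by norm_num, 0, ?_⟩
      apply IsBigO.of_bound C
      filter_upwards [mem_inf_of_right (mem_principal_self _)] with x hx
      simpa using hbound' x (le_of_lt hx)
    · intro n
      have hlog : Tendsto (fun x : ℝ => Real.log x) atTop atTop := Real.tendsto_log_atTop
      apply squeeze_zero_norm' (a := fun x : ℝ => C * Real.exp (-x))
      · filter_upwards [hlog.eventually_ge_atTop ((n + 1) / (c / 2)), eventually_gt_atTop 0]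
          with x hx hx0
        have h1 := hbound x (by simpa using hx0.le)
        rw [norm_mul, norm_pow, norm_norm, Real.norm_eq_abs, Real.abs_exp, ← Real.exp_nat_mul]
        have h2 : (x + R : ℂ).re = x + R := by simp
        have h3 : ‖(x + R : ℂ)‖ = x + R := by
          rw [← Complex.ofReal_add, Complex.norm_real, Real.norm_eq_abs, abs_of_pos (by linarith)]
        rw [h2, h3] at h1
        have h4 : (n + 1 : ℝ) ≤ c / 2 * Real.log (x + R) := by
          rw [div_le_iff₀ (by positivity)] at hx
          have : Real.log x ≤ Real.log (x + R) := Real.log_le_log hx0 (by linarith)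
          nlinarith
        have h5 : (n + 1 : ℝ) * x ≤ c / 2 * ((x + R) * Real.log (x + R)) := by
          have : (n + 1 : ℝ) * x ≤ c / 2 * Real.log (x + R) * (x + R) :=
            mul_le_mul h4 (by linarith) hx0.le (by linarith [n.cast_nonneg (α := ℝ)])
          linarith
        calc _ ≤ Real.exp (n * x) * (C * Real.exp (-(c / 2 * ((x + R) * Real.log (x + R))))) := by
              gcongr
          _ ≤ Real.exp (n * x) * (C * Real.exp (-((n + 1) * x))) := by gcongr
          _ = C * Real.exp (-x) := by
              rw [mul_left_comm, ← Real.exp_add]; ring_nf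
      · simpa using (Real.tendsto_exp_neg_atTop_nhds_zero).const_mul C
    · exact ⟨C, fun x => hbound' _ (by simp)⟩
  have hs : (0 : ℝ) < 1 / (2 * R) := by positivity
  -- This smaller disk is the image of `Re ξ > R` under inversion; the identity theorem then reaches
  -- the whole disk.
  have hsmall : Set.EqOn F 0 (ball ((1 / (2 * R) : ℝ) : ℂ) (1 / (2 * R))) := by
    intro w hw
    have hw0 := ne_zero_of_mem_ball_self hw
    rw [mem_ball_self_iff hs] at hw
    have hpos := Complex.normSq_pos.2 hw0
    have h1 : R ≤ (w⁻¹).re := by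
      rw [Complex.inv_re, le_div_iff₀ hpos]
      have : R * (2 * (1 / (2 * R)) * w.re) = w.re := by field_simp
      nlinarith
    have h2 : f (w⁻¹ - R) = 0 := hzero (by simpa using h1)
    rw [hf] at h2
    simpa using h2
  refine (hF.analyticOnNhd isOpen_ball).eqOn_zero_of_preconnected_of_eventuallyEq_zero
    (convex_ball _ _).isPreconnected (z₀ := ((1 / (2 * R) : ℝ) : ℂ)) ?_ ?_
  · rw [mem_ball_self_iff hρ, Complex.normSq_ofReal, Complex.ofReal_re]
    have : 1 / (2 * R) < 2 * ρ := by
      rw [div_lt_iff₀ (by positivity)]; nlinarith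
    gcongr
  · exact hsmall.eventuallyEq_of_mem (ball_mem_nhds _ hs)

theorem eqOn_zero_of_flat {ρ c₀ c₁ : ℝ} (hρ : 0 < ρ) (hc₀ : 0 ≤ c₀) (hc₁ : 0 ≤ c₁) {F : ℂ → ℂ}
    (hF : DifferentiableOn ℂ F (ball (ρ : ℂ) ρ))
    (h : ∀ N : ℕ, ∀ w ∈ ball (ρ : ℂ) ρ,
      ‖F w‖ ≤ c₀ * c₁ ^ N * (2 * N).factorial * ‖w‖ ^ (2 * N)) :
    Set.EqOn F 0 (ball (ρ : ℂ) ρ) := by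
  refine eqOn_zero_of_exp_decay (C := 4 * c₀) (c := 1 / (2 * (c₁ + 1))) hρ (by positivity) hF
    fun w hw => ?_
  exact exp_decay_of_flat (by positivity) (by nlinarith) hc₀ hc₁
    (norm_pos_iff.2 (ne_zero_of_mem_ball_self hw)) (norm_nonneg _) (fun N => h N w hw)

/-! ### Calculus of asymptotic expansions -/

section Expansions

variable {E : Type*} [NormedAddCommGroup E] [NormedSpace ℂ E]
variable {E' : Type*} [NormedAddCommGroup E'] [NormedSpace ℂ E']

theorem gamma_one_add_pos {τ : ℝ} (hτ : 0 ≤ τ) (N : ℕ) : 0 < Real.Gamma (1 + N * τ) :=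
  Real.Gamma_pos_of_pos (by positivity)

theorem HasGevreyExpansionOn.mono {τ : ℝ} {l : ℂ} {s t : Set ℂ} {f : ℂ → E} {a : ℕ → E}
    (h : HasGevreyExpansionOn τ l s f a) (hts : t ⊆ s) : HasGevreyExpansionOn τ l t f a := by
  obtain ⟨hd, c₀, h0, c₁, h1, hb⟩ := h
  exact ⟨hd.mono hts, c₀, h0, c₁, h1, fun N q hq => hb N q (hts hq)⟩

theorem HasGevreyExpansionOn.add {τ : ℝ} (hτ : 0 ≤ τ) {l : ℂ} {s : Set ℂ} {f g : ℂ → E}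
    {a b : ℕ → E} (hf : HasGevreyExpansionOn τ l s f a) (hg : HasGevreyExpansionOn τ l s g b) :
    HasGevreyExpansionOn τ l s (fun q => f q + g q) (fun n => a n + b n) := by
  obtain ⟨hfd, c₀, h0, c₁, h1, hfb⟩ := hf
  obtain ⟨hgd, d₀, k0, d₁, k1, hgb⟩ := hg
  refine ⟨hfd.add hgd, c₀ + d₀, by positivity, max c₁ d₁, lt_max_of_lt_left h1, fun N q hq => ?_⟩
  have hG := gamma_one_add_pos hτ N
  have e : f q + g q - ∑ n ∈ Finset.range N, (q - l) ^ n • (a n + b n) =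
      (f q - ∑ n ∈ Finset.range N, (q - l) ^ n • a n) +
      (g q - ∑ n ∈ Finset.range N, (q - l) ^ n • b n) := by
    simp only [smul_add, Finset.sum_add_distrib]; abel
  rw [e]
  calc _ ≤ _ := norm_add_le _ _
    _ ≤ c₀ * c₁ ^ N * Real.Gamma (1 + N * τ) * ‖q - l‖ ^ N +
        d₀ * d₁ ^ N * Real.Gamma (1 + N * τ) * ‖q - l‖ ^ N := add_le_add (hfb N q hq) (hgb N q hq)
    _ ≤ c₀ * (max c₁ d₁) ^ N * Real.Gamma (1 + N * τ) * ‖q - l‖ ^ N +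
        d₀ * (max c₁ d₁) ^ N * Real.Gamma (1 + N * τ) * ‖q - l‖ ^ N := by
      gcongr
      · exact le_max_left _ _
      · exact le_max_right _ _
    _ = _ := by ring

theorem HasGevreyExpansionOn.clm_comp {τ : ℝ} (hτ : 0 ≤ τ) {l : ℂ} {s : Set ℂ} {f : ℂ → E}
    {a : ℕ → E} (L : E →L[ℂ] E') (hf : HasGevreyExpansionOn τ l s f a) :
    HasGevreyExpansionOn τ l s (fun q => L (f q)) (fun n => L (a n)) := by
  obtain ⟨hfd, c₀, h0, c₁, h1, hfb⟩ := hf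
  refine ⟨L.differentiable.comp_differentiableOn hfd, (‖L‖ + 1) * c₀, by positivity, c₁, h1,
    fun N q hq => ?_⟩
  have hG := gamma_one_add_pos hτ N
  have e : L (f q) - ∑ n ∈ Finset.range N, (q - l) ^ n • L (a n) =
      L (f q - ∑ n ∈ Finset.range N, (q - l) ^ n • a n) := by
    simp [map_sub, map_sum]
  rw [e]
  calc _ ≤ ‖L‖ * _ := L.le_opNorm _
    _ ≤ (‖L‖ + 1) * (c₀ * c₁ ^ N * Real.Gamma (1 + N * τ) * ‖q - l‖ ^ N) := by
      gcongr
      · linarith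
      · exact hfb N q hq
    _ = _ := by ring

theorem HasGevreyExpansionOn.sub {τ : ℝ} (hτ : 0 ≤ τ) {l : ℂ} {s : Set ℂ} {f g : ℂ → E}
    {a b : ℕ → E} (hf : HasGevreyExpansionOn τ l s f a) (hg : HasGevreyExpansionOn τ l s g b) :
    HasGevreyExpansionOn τ l s (fun q => f q - g q) (fun n => a n - b n) := by
  simpa [sub_eq_add_neg] using
    hf.add hτ (hg.clm_comp hτ (-(ContinuousLinearMap.id ℂ E)))

/-- Uniqueness of asymptotic coefficients: once the earlier ones vanish, `(q - l)^N a_N` is `O((q -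
l)^(N+1))`, and dividing and letting `q → l` gives `a_N = 0`. Flatness is needed only on a subset
accumulating at `l`. -/
theorem HasGevreyExpansionOn.eq_zero_of_isBigO {τ : ℝ} {l : ℂ} {s : Set ℂ} {f : ℂ → E}
    {a : ℕ → E} (hf : HasGevreyExpansionOn τ l s f a) {t : Set ℂ} (hts : t ⊆ s) (hl : l ∉ t)
    (hcl : l ∈ closure t) (hO : ∀ N : ℕ, f =O[𝓝[t] l] fun q => (q - l) ^ N) (n : ℕ) :
    a n = 0 := by
  obtain ⟨-, c₀, -, c₁, -, hb⟩ := hf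
  have : (𝓝[t] l).NeBot := mem_closure_iff_nhdsWithin_neBot.1 hcl
  induction n using Nat.strong_induction_on with
  | _ N ih =>
  have h1 : (fun q => f q - ∑ n ∈ Finset.range (N + 1), (q - l) ^ n • a n)
      =O[𝓝[t] l] fun q => (q - l) ^ (N + 1) := by
    apply IsBigO.of_bound (c₀ * c₁ ^ (N + 1) * Real.Gamma (1 + (N + 1 : ℕ) * τ))
    filter_upwards [self_mem_nhdsWithin] with q hq
    rw [norm_pow]
    exact hb (N + 1) q (hts hq)
  have h2 : (fun q => (q - l) ^ N • a N) =O[𝓝[t] l] fun q => (q - l) ^ (N + 1) := by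
    refine ((hO (N + 1)).sub h1).congr_left fun q => ?_
    rw [Finset.sum_range_succ, Finset.sum_eq_zero fun k hk => ?_]
    · simp
    · rw [ih k (Finset.mem_range.1 hk), smul_zero]
  have h3 : (fun _ : ℂ => a N) =O[𝓝[t] l] fun q => q - l := by
    obtain ⟨C, hC⟩ := h2.bound
    apply IsBigO.of_bound C
    filter_upwards [hC, self_mem_nhdsWithin] with q hq hqt
    have hne : 0 < ‖q - l‖ := norm_pos_iff.2 (sub_ne_zero.2 fun h => hl (h ▸ hqt))
    rw [norm_smul, norm_pow, norm_pow, pow_succ] at hq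
    have : ‖q - l‖ ^ N * ‖a N‖ ≤ ‖q - l‖ ^ N * (C * ‖q - l‖) := by linarith
    exact le_of_mul_le_mul_left this (by positivity)
  have h4 : Tendsto (fun q : ℂ => q - l) (𝓝[t] l) (𝓝 0) := by
    have : Tendsto (fun q : ℂ => q - l) (𝓝 l) (𝓝 (l - l)) := by
      exact (continuous_id.sub continuous_const).tendsto l
    rw [sub_self] at this
    exact this.mono_left nhdsWithin_le_nhds
  exact tendsto_nhds_unique tendsto_const_nhds (h3.trans_tendsto h4)

/-! ### Tangent disks -/

theorem ball_subset_ball_of_norm_sub_le {ρ ρ' : ℝ} {c c' : ℂ} (hc : ‖c' - c‖ ≤ ρ - ρ') : ball c' ρ' ⊆ ball c ρ := by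
  apply ball_subset_ball'
  rw [dist_eq_norm]; linarith

theorem tangent_in_subset {ρ ρ' : ℝ} (h : ρ' ≤ ρ) {l : ℂ} (hl : ‖l‖ = 1) :
    ball ((1 - ρ') * l) ρ' ⊆ ball ((1 - ρ) * l) ρ := by
  apply ball_subset_ball_of_norm_sub_le
  have : (1 - (ρ' : ℂ)) * l - (1 - ρ) * l = ((ρ - ρ' : ℝ) : ℂ) * l := by push_cast; ring
  rw [this, norm_mul, hl, mul_one, Complex.norm_real, Real.norm_eq_abs,
    abs_of_nonneg (by linarith)]

theorem tangent_out_subset {ρ ρ' : ℝ} (h : ρ' ≤ ρ) {l : ℂ} (hl : ‖l‖ = 1) :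
    ball ((1 + ρ') * l) ρ' ⊆ ball ((1 + ρ) * l) ρ := by
  apply ball_subset_ball_of_norm_sub_le
  have : (1 + (ρ' : ℂ)) * l - (1 + ρ) * l = ((ρ' - ρ : ℝ) : ℂ) * l := by push_cast; ring
  rw [this, norm_mul, hl, mul_one, Complex.norm_real, Real.norm_eq_abs,
    abs_of_nonpos (by linarith)]
  linarith

theorem tangentDisks_mono {ρ ρ' : ℝ} (h : ρ' ≤ ρ) {l : ℂ} (hl : ‖l‖ = 1) :
    tangentDisks l ρ' ⊆ tangentDisks l ρ :=
  Set.union_subset_union (tangent_in_subset h hl) (tangent_out_subset h hl)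

theorem isOpen_tangentDisks (l : ℂ) (ρ : ℝ) : IsOpen (tangentDisks l ρ) :=
  isOpen_ball.union isOpen_ball

theorem norm_ne_one_of_mem_tangentDisks {ρ : ℝ} (hρ : ρ < 1) {l q : ℂ} (hl : ‖l‖ = 1)
    (hq : q ∈ tangentDisks l ρ) : ‖q‖ ≠ 1 := by
  rcases hq with hq | hq
  · rw [mem_ball, dist_eq_norm] at hq
    have h1 : ‖(1 - (ρ : ℂ)) * l‖ = 1 - ρ := by
      rw [norm_mul, hl, mul_one, ← Complex.ofReal_one, ← Complex.ofReal_sub, Complex.norm_real,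
        Real.norm_eq_abs, abs_of_pos (by linarith)]
    have := norm_le_norm_add_norm_sub' q ((1 - (ρ : ℂ)) * l)
    intro h; linarith
  · rw [mem_ball, dist_eq_norm] at hq
    have hρ0 : 0 < ρ := (norm_nonneg _).trans_lt hq
    have h1 : ‖(1 + (ρ : ℂ)) * l‖ = 1 + ρ := by
      rw [norm_mul, hl, mul_one, ← Complex.ofReal_one, ← Complex.ofReal_add, Complex.norm_real,
        Real.norm_eq_abs, abs_of_pos (by linarith)]
    have := norm_le_norm_add_norm_sub q ((1 + (ρ : ℂ)) * l)
    intro h; linarith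

theorem notMem_tangentDisks {ρ : ℝ} (hρ : ρ < 1) {l : ℂ} (hl : ‖l‖ = 1) :
    l ∉ tangentDisks l ρ :=
  fun h => norm_ne_one_of_mem_tangentDisks hρ hl h hl

theorem radial_out_mem {ρ x : ℝ} (hx : 0 < x) (hxρ : x < 2 * ρ) {l : ℂ} (hl : ‖l‖ = 1) :
    l * (1 + x) ∈ ball ((1 + ρ) * l) ρ := by
  rw [mem_ball, dist_eq_norm]
  have : l * (1 + x) - (1 + ρ) * l = l * ((x - ρ : ℝ) : ℂ) := by push_cast; ring
  rw [this, norm_mul, hl, one_mul, Complex.norm_real, Real.norm_eq_abs, abs_lt]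
  constructor <;> linarith

theorem radial_in_mem {ρ x : ℝ} (hx : 0 < x) (hxρ : x < 2 * ρ) {l : ℂ} (hl : ‖l‖ = 1) :
    l * (1 - x) ∈ ball ((1 - ρ) * l) ρ := by
  rw [mem_ball, dist_eq_norm]
  have : l * (1 - x) - (1 - ρ) * l = l * ((ρ - x : ℝ) : ℂ) := by push_cast; ring
  rw [this, norm_mul, hl, one_mul, Complex.norm_real, Real.norm_eq_abs, abs_lt]
  constructor <;> linarith

theorem mem_closure_of_radial {t : Set ℂ} {ε : ℝ} (hε : 0 < ε) {l : ℂ}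
    (h : ∀ x : ℝ, 0 < x → x < ε → l * (1 + x) ∈ t) : l ∈ closure t := by
  have hlim : Tendsto (fun x : ℝ => l * (1 + (x : ℂ))) (𝓝[>] 0) (𝓝 l) := by
    have : Continuous fun x : ℝ => l * (1 + (x : ℂ)) := by fun_prop
    have := this.tendsto 0
    simp only [Complex.ofReal_zero, add_zero, mul_one] at this
    exact this.mono_left nhdsWithin_le_nhds
  refine mem_closure_of_tendsto hlim ?_
  filter_upwards [Ioo_mem_nhdsGT hε] with x hx
  exact h x hx.1 hx.2

theorem HasGevreyExpansionOn.hasAsymptoticExpansion {τ : ℝ} {l : ℂ} (hl : ‖l‖ = 1) {ρ : ℝ}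
    (hρ : ρ ∈ Set.Ioo (0 : ℝ) 1) {k : ℕ} {f : ℂ → E} {a : ℕ → E}
    (h : HasGevreyExpansionOn τ l (tangentDisks l ρ) (fun q => (q - l) ^ k • f q) a) :
    HasAsymptoticExpansion l k f a := by
  obtain ⟨-, c₀, -, c₁, -, hb⟩ := h
  refine ⟨ρ, hρ, fun N => IsBigO.of_bound (c₀ * c₁ ^ N * Real.Gamma (1 + N * τ)) ?_⟩
  filter_upwards [self_mem_nhdsWithin] with q hq
  have hne : q - l ≠ 0 := sub_ne_zero.2 fun h => notMem_tangentDisks hρ.2 hl (h ▸ hq)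
  have hpos : 0 < ‖q - l‖ := norm_pos_iff.2 hne
  have e : f q - ∑ n ∈ Finset.range N, (q - l) ^ ((n : ℤ) - k) • a n =
      ((q - l) ^ k)⁻¹ • ((q - l) ^ k • f q - ∑ n ∈ Finset.range N, (q - l) ^ n • a n) := by
    rw [smul_sub, smul_smul, inv_mul_cancel₀ (pow_ne_zero _ hne), one_smul, Finset.smul_sum]
    congr 1
    refine Finset.sum_congr rfl fun n _ => ?_
    rw [smul_smul, zpow_sub₀ hne, zpow_natCast, zpow_natCast, div_eq_inv_mul]
  rw [e, norm_smul, norm_inv, norm_pow, zpow_sub₀ hne, zpow_natCast, zpow_natCast, norm_div,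
    norm_pow, norm_pow]
  calc _ ≤ (‖q - l‖ ^ k)⁻¹ * (c₀ * c₁ ^ N * Real.Gamma (1 + N * τ) * ‖q - l‖ ^ N) := by
        gcongr; exact hb N q hq
    _ = _ := by ring

/-- The common partial sums cancel; the factor `(q - l)^k` clears the possible pole. -/
theorem HasAsymptoticExpansion.sub_isBigO {l : ℂ} (hl : ‖l‖ = 1) {k : ℕ} {f₁ f₂ : ℂ → E}
    {a : ℕ → E} (h₁ : HasAsymptoticExpansion l k f₁ a) (h₂ : HasAsymptoticExpansion l k f₂ a) :
    ∃ ρ ∈ Set.Ioo (0 : ℝ) 1, ∀ N : ℕ,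
      (fun q => (q - l) ^ k • (f₁ q - f₂ q)) =O[𝓝[tangentDisks l ρ] l] fun q => (q - l) ^ N := by
  obtain ⟨ρ₁, hρ₁, h₁⟩ := h₁
  obtain ⟨ρ₂, hρ₂, h₂⟩ := h₂
  refine ⟨min ρ₁ ρ₂, ⟨lt_min hρ₁.1 hρ₂.1, min_lt_of_left_lt hρ₁.2⟩, fun N => ?_⟩
  have h1 := (h₁ N).mono (nhdsWithin_mono l (tangentDisks_mono (min_le_left ρ₁ ρ₂) hl))
  have h2 := (h₂ N).mono (nhdsWithin_mono l (tangentDisks_mono (min_le_right ρ₁ ρ₂) hl))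
  obtain ⟨C, hC⟩ := (h1.sub h2).bound
  apply IsBigO.of_bound C
  filter_upwards [hC, self_mem_nhdsWithin] with q hq hqt
  have hne : q - l ≠ 0 := sub_ne_zero.2 fun h =>
    notMem_tangentDisks (min_lt_of_left_lt hρ₁.2) hl (h ▸ hqt)
  have hpos : 0 < ‖q - l‖ := norm_pos_iff.2 hne
  rw [sub_sub_sub_cancel_right, zpow_sub₀ hne, zpow_natCast, zpow_natCast, norm_div, norm_pow,
    norm_pow, ← mul_div_assoc, le_div_iff₀ (by positivity)] at hq
  rw [norm_smul, norm_pow, norm_pow]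
  linarith

end Expansions

/-! ### Flat Gevrey functions and quasianalyticity of the pole class -/

theorem HasGevreyExpansionOn.norm_le_of_coeff_eq_zero {m : ℕ} {l : ℂ} {s : Set ℂ} {f : ℂ → ℂ}
    {a : ℕ → ℂ} (hf : HasGevreyExpansionOn m l s f a) (ha : ∀ n, a n = 0) :
    ∃ c₀ : ℝ, 0 < c₀ ∧ ∃ c₁ : ℝ, 0 < c₁ ∧ ∀ N : ℕ, ∀ q ∈ s,
      ‖f q‖ ≤ c₀ * c₁ ^ N * (m * N).factorial * ‖q - l‖ ^ N := by
  obtain ⟨-, c₀, h0, c₁, h1, hb⟩ := hf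
  refine ⟨c₀, h0, c₁, h1, fun N q hq => ?_⟩
  have h := hb N q hq
  have hG : Real.Gamma (1 + N * m) = (m * N).factorial := by
    rw [← Real.Gamma_nat_eq_factorial]; push_cast; ring_nf
  rw [hG] at h
  simpa [ha] using h

/-- Watson's lemma in a disk tangent at `l` to the unit circle; `κ = -1` is the inner disk and
`κ = 1` the outer one. -/
theorem eqOn_zero_of_gevrey_one_flat {l : ℂ} (hl : ‖l‖ = 1) {ρ : ℝ} (hρ : 0 < ρ) {κ : ℂ}
    (hκ : ‖κ‖ = 1) {f : ℂ → ℂ} {a : ℕ → ℂ}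
    (hf : HasGevreyExpansionOn 1 l (ball ((1 + κ * ρ) * l) ρ) f a) (ha : ∀ n, a n = 0) :
    Set.EqOn f 0 (ball ((1 + κ * ρ) * l) ρ) := by
  have hκ0 : κ ≠ 0 := norm_pos_iff.1 (by rw [hκ]; exact one_pos)
  have hl0 : l ≠ 0 := norm_pos_iff.1 (by rw [hl]; exact one_pos)
  have hf' : HasGevreyExpansionOn (1 : ℕ) l (ball ((1 + κ * ρ) * l) ρ) f a := by
    simpa using hf
  obtain ⟨c₀, h0, c₁, h1, hb⟩ := hf'.norm_le_of_coeff_eq_zero ha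
  have hmem : ∀ w : ℂ, l * (1 + κ * w) ∈ ball ((1 + κ * ρ) * l) ρ ↔ w ∈ ball (ρ : ℂ) ρ := by
    intro w
    rw [mem_ball, mem_ball, dist_eq_norm, dist_eq_norm]
    have : l * (1 + κ * w) - (1 + κ * ρ) * l = l * κ * (w - ρ) := by ring
    rw [this, norm_mul, norm_mul, hl, hκ, one_mul, one_mul]
  have key := eqOn_zero_of_flat (F := fun w => f (l * (1 + κ * w))) hρ h0.le (sq_nonneg c₁)
    (hf.1.comp (by fun_prop) fun w hw => (hmem w).2 hw) (fun N w hw => by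
      -- Only even orders are used, so `c₁ ^ 2` plays the role of the constant in
      -- `eqOn_zero_of_flat`.
      have := hb (2 * N) _ ((hmem w).2 hw)
      have e : l * (1 + κ * w) - l = l * κ * w := by ring
      rw [e, norm_mul, norm_mul, hl, hκ, one_mul, one_mul, one_mul, pow_mul c₁] at this
      exact this)
  intro q hq
  have e : q = l * (1 + κ * ((q / l - 1) / κ)) := by field_simp; ring
  rw [e] at hq ⊢
  exact key ((hmem _).1 hq)

/-- The difference multiplied by `q - l` is Gevrey-1 with zero expansion, so Watson's lemma kills it
in a small disk on each side. The factor `q - l` has no zero there, and the identity theorem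
enlarges the disks. -/
theorem isQuasianalyticAt_poleGevreyClass {l : ℂ} (hl : ‖l‖ = 1) :
    IsQuasianalyticAt l 1 (poleGevreyClass 1 l ℂ) := by
  refine ⟨?_, ?_⟩
  · rintro f ⟨ρ, hρ, a, h⟩
    exact ⟨a, HasGevreyExpansionOn.hasAsymptoticExpansion (τ := 1) hl hρ (by simpa using h)⟩
  · rintro f₁ ⟨ρ₁, hρ₁, a₁, h₁⟩ f₂ ⟨ρ₂, hρ₂, a₂, h₂⟩ a e₁ e₂ ρ hρ hd₁ hd₂
    obtain ⟨ρ₃, hρ₃, hO⟩ := e₁.sub_isBigO hl e₂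
    set σ := min (min ρ₁ ρ₂) (min ρ₃ ρ) with hσ
    have hσ1 : σ ≤ ρ₁ := (min_le_left _ _).trans (min_le_left _ _)
    have hσ2 : σ ≤ ρ₂ := (min_le_left _ _).trans (min_le_right _ _)
    have hσ3 : σ ≤ ρ₃ := (min_le_right _ _).trans (min_le_left _ _)
    have hσ4 : σ ≤ ρ := (min_le_right _ _).trans (min_le_right _ _)
    have hσ0 : 0 < σ := lt_min (lt_min hρ₁.1 hρ₂.1) (lt_min hρ₃.1 hρ.1)
    have hσlt : σ < 1 := hσ4.trans_lt hρ.2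
    have hd := (h₁.mono (tangentDisks_mono hσ1 hl)).sub zero_le_one
      (h₂.mono (tangentDisks_mono hσ2 hl))
    have hz := hd.eq_zero_of_isBigO (t := tangentDisks l σ) subset_rfl
      (notMem_tangentDisks hσlt hl)
      (mem_closure_of_radial (ε := 2 * σ) (by positivity)
        fun x hx hx' => Or.inr (radial_out_mem hx hx' hl))
      (fun N => ((hO N).mono (nhdsWithin_mono l (tangentDisks_mono hσ3 hl))).congr_left
        fun q => by rw [pow_one, smul_sub])
    -- The inner and outer disks are treated separately: no connection between them is available or
    -- needed.
    have hdisk : ∀ κ : ℂ, ‖κ‖ = 1 → (∀ ρ' : ℝ, ball ((1 + κ * ρ') * l) ρ' ⊆ tangentDisks l ρ') →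
        ball ((1 + κ * σ) * l) σ ⊆ ball ((1 + κ * ρ) * l) ρ →
        Set.EqOn f₁ f₂ (ball ((1 + κ * ρ) * l) ρ) := by
      intro κ hκ hsub hnest
      have hflat := eqOn_zero_of_gevrey_one_flat hl hσ0 hκ (hd.mono (hsub σ)) hz
      have hz' : Set.EqOn (fun q => f₁ q - f₂ q) 0 (ball ((1 + κ * σ) * l) σ) := by
        intro q hq
        have h := hflat hq
        have hne : q - l ≠ 0 := sub_ne_zero.2 fun h => notMem_tangentDisks hσlt hl (h ▸ hsub σ hq)
        simp only [← smul_sub, Pi.zero_apply] at h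
        exact (smul_eq_zero.1 h).resolve_left hne
      have := (((hd₁.sub hd₂).mono (hsub ρ)).analyticOnNhd
        isOpen_ball).eqOn_zero_of_preconnected_of_eventuallyEq_zero
        (convex_ball _ _).isPreconnected (hnest (mem_ball_self hσ0))
        (hz'.eventuallyEq_of_mem (ball_mem_nhds _ hσ0))
      exact fun q hq => sub_eq_zero.1 (this hq)
    rintro q (hq | hq)
    · have := hdisk (-1) (by simp) (fun ρ' q hq => Or.inl (by simpa [sub_eq_add_neg] using hq))
        (by simpa [sub_eq_add_neg] using tangent_in_subset hσ4 hl)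
      exact this (by simpa [sub_eq_add_neg] using hq)
    · have := hdisk 1 (by simp) (fun ρ' q hq => Or.inr (by simpa using hq))
        (by simpa using tangent_out_subset hσ4 hl)
      exact this (by simpa using hq)

/-! ### Cardioids -/

/-- The cardioids of both kinds: `J = I` gives `cardioidLT` and `J = -I` gives `cardioidGT`. -/
def cardioid (J l : ℂ) (ρ : ℝ) : Set ℂ :=
  (fun u : ℂ => l * (1 + J * (u - 1) ^ 2)) '' ball (1 + ρ : ℂ) ρ

theorem cardioidGT_eq (l : ℂ) (ρ : ℝ) : cardioidGT l ρ = cardioid (-Complex.I) l ρ := by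
  simp only [cardioidGT, cardioid, neg_mul, sub_eq_add_neg]

theorem mem_cardioid_iff {J l q : ℂ} {ρ : ℝ} :
    q ∈ cardioid J l ρ ↔ ∃ w ∈ ball (ρ : ℂ) ρ, l * (1 + J * w ^ 2) = q := by
  constructor
  · rintro ⟨u, hu, rfl⟩
    refine ⟨u - 1, ?_, rfl⟩
    rw [mem_ball, dist_eq_norm] at hu ⊢
    rwa [sub_sub]
  · rintro ⟨w, hw, rfl⟩
    refine ⟨1 + w, ?_, by simp⟩
    rw [mem_ball, dist_eq_norm] at hw ⊢
    rwa [add_sub_add_left_eq_sub]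

theorem cardioid_mono {J l : ℂ} {ρ ρ' : ℝ} (h : ρ' ≤ ρ) : cardioid J l ρ' ⊆ cardioid J l ρ := by
  apply Set.image_mono
  apply ball_subset_ball_of_norm_sub_le
  rw [add_sub_add_left_eq_sub, ← Complex.ofReal_sub, Complex.norm_real, Real.norm_eq_abs,
    abs_of_nonpos (by linarith)]
  linarith

theorem isOpen_cardioid {J l : ℂ} (hJ : J ≠ 0) (hl : l ≠ 0) (ρ : ℝ) :
    IsOpen (cardioid J l ρ) := by
  rw [isOpen_iff_mem_nhds]
  rintro _ ⟨u, hu, rfl⟩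
  have hne : u - 1 ≠ 0 := by
    have h : u - 1 ∈ ball (ρ : ℂ) ρ := by
      rw [mem_ball, dist_eq_norm] at hu ⊢
      rwa [sub_sub]
    exact ne_zero_of_mem_ball_self h
  -- The only critical point of the squaring map, `u = 1`, lies on the boundary of the disk, so the
  -- image is open by the inverse function theorem.
  have hder : HasStrictDerivAt (fun u : ℂ => l * (1 + J * (u - 1) ^ 2))
      (l * (J * (2 * (u - 1)))) u := by
    have h1 : HasStrictDerivAt (fun u : ℂ => (u - 1) ^ 2) (2 * (u - 1)) u := by
      have h0 : HasStrictDerivAt (fun u : ℂ => u - 1) 1 u := (hasStrictDerivAt_id u).sub_const 1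
      exact (h0.pow 2).congr_deriv (by simp)
    exact ((h1.const_mul J).const_add 1).const_mul l
  have hder0 : l * (J * (2 * (u - 1))) ≠ 0 := by
    simp [hJ, hl, hne]
  rw [← hder.map_nhds_eq hder0]
  exact image_mem_map (isOpen_ball.mem_nhds hu)

/-- The square roots of `±ix` with positive real part are `s(1 ± i)` with `s = √(x/2)`, and they lie
in the disk as soon as `s < ρ`. Hence the cardioid surrounds its cusp widely enough to meet both
tangent disks. -/
theorem radial_mem_cardioid {J l : ℂ} (hJ : J = Complex.I ∨ J = -Complex.I) {ρ x : ℝ}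
    (hρ : 0 < ρ) (hx : 0 < x) (hxρ : x < 2 * ρ ^ 2) :
    l * (1 + x) ∈ cardioid J l ρ ∧ l * (1 - x) ∈ cardioid J l ρ := by
  set s := Real.sqrt (x / 2) with hs
  have hs2 : s ^ 2 = x / 2 := Real.sq_sqrt (by positivity)
  have hsx : (x : ℂ) = 2 * (s : ℂ) ^ 2 := by
    rw [← Complex.ofReal_pow, hs2]; push_cast; ring
  have hs0 : 0 < s := Real.sqrt_pos.2 (by positivity)
  have hsρ : s < ρ := by nlinarith
  have hp : (s : ℂ) * (1 + Complex.I) ∈ ball (ρ : ℂ) ρ := by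
    rw [mem_ball_self_iff hρ]
    simp [Complex.normSq_apply]
    nlinarith
  have hm : (s : ℂ) * (1 - Complex.I) ∈ ball (ρ : ℂ) ρ := by
    rw [mem_ball_self_iff hρ]
    simp [Complex.normSq_apply]
    nlinarith
  have ep : ((s : ℂ) * (1 + Complex.I)) ^ 2 = Complex.I * x := by
    rw [hsx]; ring_nf; rw [Complex.I_sq]; ring
  have em : ((s : ℂ) * (1 - Complex.I)) ^ 2 = -Complex.I * x := by
    rw [hsx]; ring_nf; rw [Complex.I_sq]; ring
  have hI : ∀ y : ℂ, Complex.I * (Complex.I * y) = -y := fun y => by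
    rw [← mul_assoc, Complex.I_mul_I, neg_one_mul]
  rcases hJ with rfl | rfl
  · refine ⟨mem_cardioid_iff.2 ⟨_, hm, ?_⟩, mem_cardioid_iff.2 ⟨_, hp, ?_⟩⟩
    · rw [em, neg_mul, mul_neg, hI, neg_neg]
    · rw [ep, hI, sub_eq_add_neg]
  · refine ⟨mem_cardioid_iff.2 ⟨_, hp, ?_⟩, mem_cardioid_iff.2 ⟨_, hm, ?_⟩⟩
    · rw [ep, neg_mul, hI, neg_neg]
    · rw [em, neg_mul, neg_mul, mul_neg, hI, neg_neg, sub_eq_add_neg]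

theorem norm_of_eq_I_or_neg_I {J : ℂ} (hJ : J = Complex.I ∨ J = -Complex.I) : ‖J‖ = 1 := by
  rcases hJ with rfl | rfl <;> simp

/-- Watson's lemma in a cardioid. -/
theorem eqOn_zero_of_gevrey_two_flat {J l : ℂ} (hl : ‖l‖ = 1) (hJ : ‖J‖ = 1) {ρ : ℝ} (hρ : 0 < ρ)
    {f : ℂ → ℂ} {a : ℕ → ℂ} (hf : HasGevreyExpansionOn 2 l (cardioid J l ρ) f a)
    (ha : ∀ n, a n = 0) : Set.EqOn f 0 (cardioid J l ρ) := by
  have hf' : HasGevreyExpansionOn (2 : ℕ) l (cardioid J l ρ) f a := by simpa using hf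
  obtain ⟨c₀, h0, c₁, h1, hb⟩ := hf'.norm_le_of_coeff_eq_zero ha
  have hmem : ∀ w ∈ ball (ρ : ℂ) ρ, l * (1 + J * w ^ 2) ∈ cardioid J l ρ :=
    fun w hw => mem_cardioid_iff.2 ⟨w, hw, rfl⟩
  have key := eqOn_zero_of_flat (F := fun w => f (l * (1 + J * w ^ 2))) hρ h0.le h1.le
    (hf.1.comp (by fun_prop) hmem) (fun N w hw => by
      have := hb N _ (hmem w hw)
      have e : l * (1 + J * w ^ 2) - l = l * J * w ^ 2 := by ring
      rw [e, norm_mul, norm_mul, hl, hJ, one_mul, one_mul, norm_pow, ← pow_mul] at this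
      exact this)
  intro q hq
  obtain ⟨w, hw, rfl⟩ := mem_cardioid_iff.1 hq
  exact key hw

/-! ### The Hadamard multipliers -/

theorem differentiable_deltaCoeff (S : Set ℂ) (n : ℕ) : Differentiable ℂ (deltaCoeff S n) := by
  unfold deltaCoeff
  fun_prop

/-- At `q = 0` only `ℓ = 0` survives, giving `1/n` times the number of `n`-th roots of unity in `S`.
The root `1` is present for every `n`, so no multiplier coefficient is the zero polynomial. -/
theorem deltaCoeff_zero_ne_zero {S : Set ℂ} (hS : (1 : ℂ) ∈ S) {n : ℕ} (hn : 0 < n) :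
    deltaCoeff S n 0 ≠ 0 := by
  classical
  have hn' : (n : ℂ) ≠ 0 := by exact_mod_cast hn.ne'
  rw [deltaCoeff, Finset.sum_eq_single_of_mem 0 (Finset.mem_range.2 hn)
    (fun b _ hb => by rw [zero_pow hb, mul_zero])]
  simp only [pow_zero, inv_one, Finset.sum_const, nsmul_eq_mul, mul_one]
  refine mul_ne_zero (one_div_ne_zero hn') ?_
  rw [Nat.cast_ne_zero]
  refine Finset.card_ne_zero_of_mem (a := 1) ?_
  rw [Finset.mem_filter, Polynomial.mem_nthRootsFinset hn]
  exact ⟨one_pow n, hS⟩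

theorem norm_eq_one_of_mem_diophantinePoints {τ : ℝ} {l : ℂ} (hl : l ∈ diophantinePoints τ) :
    ‖l‖ = 1 := by
  obtain ⟨γ, -, y, -, rfl⟩ := hl
  rw [show 2 * (Real.pi : ℂ) * Complex.I * y = ((2 * Real.pi * y : ℝ) : ℂ) * Complex.I by
    push_cast; ring]
  exact Complex.norm_exp_ofReal_mul_I _

/-- Irrationality excludes `1 = l` and `1 = -l`, the only points missed by the two open half
circles. -/
theorem one_mem_arcLT_or_arcGT {τ : ℝ} {l : ℂ} (hl : l ∈ diophantinePoints τ) :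
    (1 : ℂ) ∈ arcLT l ∨ (1 : ℂ) ∈ arcGT l := by
  obtain ⟨γ, -, y, ⟨hy, -⟩, rfl⟩ := hl
  have h1 := abs_sub_round y
  set t : ℝ := round y - y with ht
  have htirr : Irrational t := hy.intCast_sub _
  have habs : |t| ≤ 1 / 2 := by rwa [ht, abs_sub_comm]
  have hexp : (1 : ℂ) = Complex.exp (2 * Real.pi * Complex.I * y) *
      Complex.exp (2 * Real.pi * Complex.I * t) := by
    rw [← Complex.exp_add, eq_comm, Complex.exp_eq_one_iff]
    refine ⟨round y, ?_⟩
    rw [ht]; push_cast; ring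
  have h0 : t ≠ 0 := htirr.ne_zero
  have hh : t ≠ 1 / 2 := fun h => htirr ⟨1 / 2, by rw [h]; push_cast; rfl⟩
  have hh' : t ≠ -(1 / 2) := fun h => htirr ⟨-(1 / 2), by rw [h]; push_cast; rfl⟩
  rw [abs_le] at habs
  rcases lt_or_gt_of_ne h0 with h | h
  · exact Or.inl ⟨t, ⟨lt_of_le_of_ne habs.1 hh'.symm, h⟩, hexp⟩
  · exact Or.inr ⟨t, ⟨h, lt_of_le_of_ne habs.2 hh⟩, hexp⟩

/-- The extension of the Hadamard product carries the uniqueness. Its `n`-th coefficient is flat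
where it equals `coeff (f₁ - f₂) n` times the multiplier, hence zero in the whole cardioid by
Watson. The cardioid meets both disks, so this product vanishes in each, and the nonzero polynomial
factor cancels. -/
theorem eqOn_of_hadamard_gevrey {J l : ℂ} (hl : ‖l‖ = 1) (hJ : J = Complex.I ∨ J = -Complex.I)
    {r : ℝ} (hr : 0 < r) {S : Set ℂ} (hS : (1 : ℂ) ∈ S) {f₁ f₂ h₁ h₂ : ℂ → B r} {a b₁ b₂ : ℕ → B r}
    {ρ₁ ρ₂ σ₁ σ₂ : ℝ} (hρ₁ : 0 < ρ₁) (hρ₂ : 0 < ρ₂) (hσ₁ : 0 < σ₁) (hσ₂ : 0 < σ₂)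
    (hh₁ : HasGevreyExpansionOn 2 l (cardioid J l ρ₁) h₁ b₁)
    (hh₂ : HasGevreyExpansionOn 2 l (cardioid J l ρ₂) h₂ b₂)
    (hf₁ : ∀ q ∈ tangentDisks l σ₁ ∩ cardioid J l σ₁, ∀ n : ℕ,
      coeff (h₁ q) n = coeff (f₁ q) n * deltaCoeff S n q)
    (hf₂ : ∀ q ∈ tangentDisks l σ₂ ∩ cardioid J l σ₂, ∀ n : ℕ,
      coeff (h₂ q) n = coeff (f₂ q) n * deltaCoeff S n q)
    (e₁ : HasAsymptoticExpansion l 0 f₁ a) (e₂ : HasAsymptoticExpansion l 0 f₂ a)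
    {ρ : ℝ} (hρ : ρ ∈ Set.Ioo (0 : ℝ) 1) (hd₁ : DifferentiableOn ℂ f₁ (tangentDisks l ρ))
    (hd₂ : DifferentiableOn ℂ f₂ (tangentDisks l ρ)) :
    Set.EqOn f₁ f₂ (tangentDisks l ρ) := by
  have hl0 : l ≠ 0 := norm_pos_iff.1 (by rw [hl]; exact one_pos)
  have hJ0 : J ≠ 0 := norm_pos_iff.1 (by rw [norm_of_eq_I_or_neg_I hJ]; exact one_pos)
  obtain ⟨ρ₃, hρ₃, hO⟩ := e₁.sub_isBigO hl e₂
  obtain ⟨σ, hσ0, hσρ₁, hσρ₂, hσσ₁, hσσ₂, hσρ₃, hσρ⟩ : ∃ σ : ℝ, 0 < σ ∧ σ ≤ ρ₁ ∧ σ ≤ ρ₂ ∧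
      σ ≤ σ₁ ∧ σ ≤ σ₂ ∧ σ ≤ ρ₃ ∧ σ ≤ ρ := by
    refine ⟨min ρ₁ (min ρ₂ (min σ₁ (min σ₂ (min ρ₃ ρ)))), ?_⟩
    simp [hρ₁, hρ₂, hσ₁, hσ₂, hρ₃.1, hρ.1]
  have hσ1 : σ < 1 := hσρ.trans_lt hρ.2
  set T := tangentDisks l σ ∩ cardioid J l σ with hT
  have hTopen : IsOpen T := (isOpen_tangentDisks l σ).inter (isOpen_cardioid hJ0 hl0 σ)
  have hε : 0 < min (2 * σ) (2 * σ ^ 2) := lt_min (by positivity) (by positivity)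
  have hclT : l ∈ closure T := mem_closure_of_radial hε fun x hx hx' =>
    ⟨Or.inr (radial_out_mem hx (hx'.trans_le (min_le_left _ _)) hl),
      (radial_mem_cardioid hJ hσ0 hx (hx'.trans_le (min_le_right _ _))).1⟩
  suffices hcoeff : ∀ n : ℕ, ∀ q ∈ tangentDisks l ρ, coeff (f₁ q - f₂ q) n = 0 by
    intro q hq
    refine eq_of_coeff_eq fun n => ?_
    have := hcoeff n q hq
    rwa [← coeffCLM_apply hr, map_sub, sub_eq_zero] at this
  intro n
  rcases Nat.eq_zero_or_pos n with rfl | hn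
  · exact fun q _ => coeff_zero_right _
  have hδd := differentiable_deltaCoeff S n
  have hH := ((hh₁.mono (cardioid_mono hσρ₁)).sub zero_le_two
    (hh₂.mono (cardioid_mono hσρ₂))).clm_comp zero_le_two (coeffCLM hr n)
  simp only [coeffCLM_apply] at hH
  have hHT : ∀ q ∈ T, coeff (h₁ q - h₂ q) n = coeff (f₁ q - f₂ q) n * deltaCoeff S n q := by
    intro q hq
    have k1 := hf₁ q ⟨tangentDisks_mono hσσ₁ hl hq.1, cardioid_mono hσσ₁ hq.2⟩ n
    have k2 := hf₂ q ⟨tangentDisks_mono hσσ₂ hl hq.1, cardioid_mono hσσ₂ hq.2⟩ n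
    rw [← coeffCLM_apply hr, ← coeffCLM_apply hr, map_sub, map_sub, coeffCLM_apply, coeffCLM_apply,
      coeffCLM_apply, coeffCLM_apply, k1, k2, sub_mul]
  have hHO : ∀ N : ℕ, (fun q => coeff (h₁ q - h₂ q) n) =O[𝓝[T] l] fun q => (q - l) ^ N := by
    intro N
    have k1 : (fun q => f₁ q - f₂ q) =O[𝓝[T] l] fun q => (q - l) ^ N := by
      refine ((hO N).mono (nhdsWithin_mono l
        (Set.inter_subset_left.trans (tangentDisks_mono hσρ₃ hl)))).congr_left fun q => ?_
      rw [pow_zero, one_smul]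
    have k2 : (fun q => coeffCLM hr n (f₁ q - f₂ q)) =O[𝓝[T] l] fun q => (q - l) ^ N :=
      ((coeffCLM hr n).isBigO_comp _ _).trans k1
    have k3 : deltaCoeff S n =O[𝓝[T] l] fun _ => (1 : ℂ) :=
      ((hδd.continuous.tendsto l).isBigO_one ℂ).mono nhdsWithin_le_nhds
    have k4 := k2.mul k3
    simp only [mul_one, coeffCLM_apply] at k4
    refine k4.congr' ?_ EventuallyEq.rfl
    filter_upwards [self_mem_nhdsWithin] with q hq
    exact (hHT q hq).symm
  have hz := hH.eq_zero_of_isBigO (t := T) Set.inter_subset_right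
    (fun h => notMem_tangentDisks hσ1 hl h.1) hclT hHO
  have hflat := eqOn_zero_of_gevrey_two_flat hl (norm_of_eq_I_or_neg_I hJ) hσ0 hH hz
  have hprod : ∀ q ∈ T, coeff (f₁ q - f₂ q) n * deltaCoeff S n q = 0 := fun q hq => by
    rw [← hHT q hq]; exact hflat hq.2
  have hD : DifferentiableOn ℂ (fun q => coeff (f₁ q - f₂ q) n) (tangentDisks l ρ) :=
    (coeffCLM hr n).differentiable.comp_differentiableOn (hd₁.sub hd₂)
  have hdisk : ∀ c : ℂ, ball c ρ ⊆ tangentDisks l ρ → (∃ q₀ ∈ ball c ρ, q₀ ∈ T) →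
      ∀ q ∈ ball c ρ, coeff (f₁ q - f₂ q) n = 0 := by
    rintro c hc ⟨q₀, hq₀, hq₀T⟩
    have hconn : IsPreconnected (ball c ρ) := (convex_ball c ρ).isPreconnected
    have a1 := (hD.mono hc).analyticOnNhd isOpen_ball
    have a2 : AnalyticOnNhd ℂ (deltaCoeff S n) (ball c ρ) :=
      hδd.differentiableOn.analyticOnNhd isOpen_ball
    have hmul := (a1.mul a2).eqOn_zero_of_preconnected_of_eventuallyEq_zero hconn hq₀ (by
      filter_upwards [hTopen.mem_nhds hq₀T] with q hq using hprod q hq)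
    -- Analytic functions on a connected set form an integral domain. If the multiplier were the
    -- vanishing factor, being entire it would vanish at `0` too.
    rcases a1.eq_zero_or_eq_zero_of_mul_eq_zero a2 hmul hconn with h | h
    · exact h
    · exfalso
      have a3 : AnalyticOnNhd ℂ (deltaCoeff S n) Set.univ :=
        hδd.differentiableOn.analyticOnNhd isOpen_univ
      have := a3.eqOn_zero_of_preconnected_of_eventuallyEq_zero isPreconnected_univ
        (Set.mem_univ q₀) (by filter_upwards [isOpen_ball.mem_nhds hq₀] with q hq using h q hq)
      exact deltaCoeff_zero_ne_zero hS hn (this (Set.mem_univ 0))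
  set x := min (2 * σ) (2 * σ ^ 2) / 2 with hx
  have hx0 : 0 < x := by positivity
  have hx1 : x < 2 * σ := (half_lt_self hε).trans_le (min_le_left _ _)
  have hx2 : x < 2 * σ ^ 2 := (half_lt_self hε).trans_le (min_le_right _ _)
  have hrad := radial_mem_cardioid (l := l) hJ hσ0 hx0 hx2
  rintro q (hq | hq)
  · refine hdisk _ (fun q hq => Or.inl hq) ⟨l * (1 - x), ?_, ?_, hrad.2⟩ q hq
    · exact radial_in_mem hx0 (by linarith) hl
    · exact Or.inl (radial_in_mem hx0 hx1 hl)
  · refine hdisk _ (fun q hq => Or.inr hq) ⟨l * (1 + x), ?_, ?_, hrad.1⟩ q hq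
    · exact radial_out_mem hx0 (by linarith) hl
    · exact Or.inr (radial_out_mem hx0 hx1 hl)

/-- For uniqueness only one of the two Hadamard conditions is used: the one for the half circle
containing `1`. -/
theorem isQuasianalyticAt_hadamardGevreyClass {τ : ℝ} {l : ℂ} (hl : l ∈ diophantinePoints τ) {r : ℝ}
    (hr : 0 < r) : IsQuasianalyticAt l 0 (hadamardGevreyClass 1 l r) := by
  have hl1 := norm_eq_one_of_mem_diophantinePoints hl
  refine ⟨?_, ?_⟩
  · rintro f ⟨⟨ρ, hρ, a, h⟩, -⟩
    exact ⟨a, HasGevreyExpansionOn.hasAsymptoticExpansion (τ := 2 * 1) hl1 hρ (by simpa using h)⟩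
  · rintro f₁ ⟨-, ⟨h₁, ⟨ρ₁, hρ₁, b₁, hh₁⟩, σ₁, hσ₁, hf₁⟩, ⟨k₁, ⟨ρ₁', hρ₁', b₁', hk₁⟩, σ₁', hσ₁', hf₁'⟩⟩
      f₂ ⟨-, ⟨h₂, ⟨ρ₂, hρ₂, b₂, hh₂⟩, σ₂, hσ₂, hf₂⟩, ⟨k₂, ⟨ρ₂', hρ₂', b₂', hk₂⟩, σ₂', hσ₂', hf₂'⟩⟩
      a e₁ e₂ ρ hρ hd₁ hd₂
    rw [mul_one] at hh₁ hh₂ hk₁ hk₂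
    rcases one_mem_arcLT_or_arcGT hl with hS | hS
    · exact eqOn_of_hadamard_gevrey hl1 (Or.inl rfl) hr hS hρ₁ hρ₂ hσ₁.1 hσ₂.1 hh₁ hh₂ hf₁ hf₂ e₁ e₂
        hρ hd₁ hd₂
    · rw [cardioidGT_eq] at hk₁ hk₂
      simp only [cardioidGT_eq] at hf₁' hf₂'
      exact eqOn_of_hadamard_gevrey hl1 (Or.inr rfl) hr hS hρ₁' hρ₂' hσ₁'.1 hσ₂'.1 hk₁ hk₂ hf₁' hf₂'
        e₁ e₂ hρ hd₁ hd₂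

/-! ### Gevrey expansions of series of simple poles -/

theorem gamma_one_add_mul_natCast (σ N : ℕ) :
    Real.Gamma (1 + N * (σ : ℝ)) = (σ * N).factorial := by
  rw [← Real.Gamma_nat_eq_factorial]; push_cast; ring_nf

theorem summable_exp_neg_div {c : ℝ} (hc : 0 < c) : Summable fun n : ℕ => Real.exp (-(n : ℝ) / c) := by
  have h := Real.summable_exp_nat_mul_iff (a := -1 / c)
  have h' := h.2 (div_neg_of_neg_of_pos (by norm_num) hc)
  refine h'.congr fun n => ?_
  congr 1; ring

theorem pow_le_factorial_mul_exp {x : ℝ} (hx : 0 ≤ x) (k : ℕ) :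
    x ^ k ≤ 8 ^ k * k.factorial * Real.exp (x / 8) := by
  have h := Real.pow_div_factorial_le_exp (x / 8) (by positivity) k
  rw [div_le_iff₀ (by positivity), div_pow, div_le_iff₀ (by positivity)] at h
  linarith

/-- Half of the exponential is spent on the moments, `e^((n+1)/8)` for each of the powers `σN` and
`d`; the other half remains summable. This is where the Gevrey factor `(σN)!` arises. -/
theorem moment_le (σ d N n : ℕ) :
    ((n : ℝ) + 1) ^ (σ * N + d) * Real.exp (-(n : ℝ) / 2) ≤
      (Real.exp (1 / 4) * 8 ^ d * d.factorial) * (8 ^ σ) ^ N * (σ * N).factorial *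
        Real.exp (-(n : ℝ) / 4) := by
  have h1 := pow_le_factorial_mul_exp (x := (n : ℝ) + 1) (by positivity) (σ * N)
  have h2 := pow_le_factorial_mul_exp (x := (n : ℝ) + 1) (by positivity) d
  calc _ = ((n : ℝ) + 1) ^ (σ * N) * ((n : ℝ) + 1) ^ d * Real.exp (-(n : ℝ) / 2) := by
        rw [pow_add]
    _ ≤ (8 ^ (σ * N) * (σ * N).factorial * Real.exp (((n : ℝ) + 1) / 8)) *
        (8 ^ d * d.factorial * Real.exp (((n : ℝ) + 1) / 8)) * Real.exp (-(n : ℝ) / 2) := by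
      gcongr
    _ = (8 ^ d * d.factorial) * (8 ^ σ) ^ N * (σ * N).factorial *
        (Real.exp (((n : ℝ) + 1) / 8) * Real.exp (((n : ℝ) + 1) / 8) *
          Real.exp (-(n : ℝ) / 2)) := by
      rw [pow_mul]; ring
    _ = (8 ^ d * d.factorial) * (8 ^ σ) ^ N * (σ * N).factorial *
        (Real.exp (1 / 4) * Real.exp (-(n : ℝ) / 4)) := by
      rw [← Real.exp_add, ← Real.exp_add, ← Real.exp_add]
      congr 2; ring
    _ = _ := by ring

section Series

variable {E : Type*} [NormedAddCommGroup E] [NormedSpace ℂ E] [CompleteSpace E]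

/-- The expansions may be summed because their constants depend on `n` only through a summable
weight; the case `N = 0` supplies the normal convergence. -/
theorem hasGevreyExpansionOn_tsum {τ : ℝ} (hτ : 0 ≤ τ) {l : ℂ} {s : Set ℂ} (hs : IsOpen s)
    {φ : ℕ → ℂ → E} {α : ℕ → ℕ → E} {c₀ c₁ : ℝ} (h0 : 0 < c₀) (h1 : 0 < c₁) {u : ℕ → ℝ}
    (hu : Summable u) (hd : ∀ n, DifferentiableOn ℂ (φ n) s)
    (hα : ∀ k, Summable fun n => α n k)
    (hb : ∀ N n, ∀ q ∈ s, ‖φ n q - ∑ k ∈ Finset.range N, (q - l) ^ k • α n k‖ ≤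
      c₀ * c₁ ^ N * Real.Gamma (1 + N * τ) * ‖q - l‖ ^ N * u n) :
    HasGevreyExpansionOn τ l s (fun q => ∑' n, φ n q) (fun k => ∑' n, α n k) := by
  have hφ : ∀ n, ∀ q ∈ s, ‖φ n q‖ ≤ c₀ * u n := fun n q hq => by
    simpa using hb 0 n q hq
  refine ⟨Complex.differentiableOn_tsum_of_summable_norm (hu.mul_left c₀) hd hs hφ,
    c₀ * (|∑' n, u n| + 1), by positivity, c₁, h1, fun N q hq => ?_⟩
  have hG := gamma_one_add_pos hτ N
  have s1 : Summable fun n => φ n q :=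
    (hu.mul_left c₀).of_norm_bounded fun n => hφ n q hq
  have s2 : HasSum (fun n => φ n q - ∑ k ∈ Finset.range N, (q - l) ^ k • α n k)
      ((∑' n, φ n q) - ∑ k ∈ Finset.range N, (q - l) ^ k • ∑' n, α n k) :=
    s1.hasSum.sub (hasSum_sum fun k _ => (hα k).hasSum.const_smul _)
  rw [← s2.tsum_eq]
  refine (tsum_of_norm_bounded (hu.hasSum.mul_left _) fun n => hb N n q hq).trans ?_
  calc _ ≤ c₀ * c₁ ^ N * Real.Gamma (1 + N * τ) * ‖q - l‖ ^ N * (|∑' n, u n| + 1) := by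
        gcongr
        linarith [le_abs_self (∑' n, u n)]
    _ = _ := by ring

theorem inv_sub_expansion {q l Λ : ℂ} (h1 : l ≠ Λ) (h2 : q ≠ Λ) (N : ℕ) :
    (q - Λ)⁻¹ - ∑ k ∈ Finset.range N, (q - l) ^ k * ((-1) ^ k / (l - Λ) ^ (k + 1)) =
      (q - l) ^ N * ((-1) ^ N / (l - Λ) ^ N) * (q - Λ)⁻¹ := by
  have h1' : l - Λ ≠ 0 := sub_ne_zero.2 h1
  have h2' : q - Λ ≠ 0 := sub_ne_zero.2 h2
  induction N with
  | zero => simp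
  | succ N ih =>
    rw [Finset.sum_range_succ, ← sub_sub, ih]
    field_simp
    ring

/-- Each remainder is at most `|q - l|^N |l - Λ|^(-N-2) / c`, so a polynomial lower bound on `|l -
Λ|` turns the sum over `n` into an exponential moment. -/
theorem hasGevreyExpansionOn_poles {σ : ℕ} {l : ℂ} {s : Set ℂ} (hs : IsOpen s)
    {T : ℕ → Finset ℂ} {v : ℕ → E} {C κ c : ℝ} (hC : 0 < C) (hκ : 0 < κ) (hc : 0 < c)
    (hT : ∀ n, (T n).card ≤ n + 1) (hv : ∀ n, ‖v n‖ ≤ C * Real.exp (-(n : ℝ) / 2))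
    (hl : ∀ n, ∀ Λ ∈ T n, κ / ((n : ℝ) + 1) ^ σ ≤ ‖l - Λ‖)
    (hq : ∀ n, ∀ Λ ∈ T n, ∀ q ∈ s, c * ‖l - Λ‖ ^ 2 ≤ ‖q - Λ‖) :
    ∃ a, HasGevreyExpansionOn σ l s (fun q => ∑' n, (∑ Λ ∈ T n, (q - Λ)⁻¹) • v n) a := by
  have hlpos : ∀ n, ∀ Λ ∈ T n, 0 < ‖l - Λ‖ := fun n Λ hΛ =>
    (by positivity : 0 < κ / ((n : ℝ) + 1) ^ σ).trans_le (hl n Λ hΛ)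
  have hqpos : ∀ n, ∀ Λ ∈ T n, ∀ q ∈ s, 0 < ‖q - Λ‖ := fun n Λ hΛ q hqs =>
    (by have := hlpos n Λ hΛ; positivity : 0 < c * ‖l - Λ‖ ^ 2).trans_le (hq n Λ hΛ q hqs)
  have hlinv : ∀ n, ∀ Λ ∈ T n, ‖l - Λ‖⁻¹ ≤ ((n : ℝ) + 1) ^ σ / κ := fun n Λ hΛ => by
    rw [← inv_div]
    exact inv_anti₀ (by positivity) (hl n Λ hΛ)
  have hsum : ∀ n (F : ℂ → ℂ) (b : ℝ), 0 ≤ b → (∀ Λ ∈ T n, ‖F Λ‖ ≤ b) →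
      ‖(∑ Λ ∈ T n, F Λ) • v n‖ ≤ ((n : ℝ) + 1) * b * (C * Real.exp (-(n : ℝ) / 2)) := by
    intro n F b hb hF
    rw [norm_smul]
    have h1 : ‖∑ Λ ∈ T n, F Λ‖ ≤ ((n : ℝ) + 1) * b := by
      calc _ ≤ ∑ Λ ∈ T n, b := norm_sum_le_of_le _ hF
        _ = (T n).card * b := by rw [Finset.sum_const, nsmul_eq_mul]
        _ ≤ _ := by
          gcongr
          exact_mod_cast hT n
    exact mul_le_mul h1 (hv n) (norm_nonneg _) (by positivity)
  refine ⟨_, hasGevreyExpansionOn_tsum (τ := σ) (by positivity) hs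
    (α := fun n k => (∑ Λ ∈ T n, (-1) ^ k / (l - Λ) ^ (k + 1)) • v n)
    -- In the extra power `2σ + 1`, `2σ` comes from the quadratic bound on `|q - Λ|` and `1` from
    -- the number of poles.
    (c₀ := C * c⁻¹ * (κ⁻¹) ^ 2 * (Real.exp (1 / 4) * 8 ^ (2 * σ + 1) * (2 * σ + 1).factorial))
    (c₁ := κ⁻¹ * 8 ^ σ) (by positivity) (by positivity)
    (summable_exp_neg_div (c := 4) (by norm_num)) (fun n => ?_) (fun k => ?_)
    fun N n q hqs => ?_⟩
  · refine DifferentiableOn.smul_const (DifferentiableOn.fun_sum fun Λ hΛ => ?_) _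
    exact (differentiableOn_id.sub_const Λ).inv fun q hqs =>
      norm_pos_iff.1 (hqpos n Λ hΛ q hqs)
  · refine ((summable_exp_neg_div (c := 4) (by norm_num)).mul_left
      (C * (κ⁻¹) ^ (k + 1) * ((Real.exp (1 / 4) * 8 ^ (σ + 1) * (σ + 1).factorial) *
        (8 ^ σ) ^ k * (σ * k).factorial))).of_norm_bounded fun n => ?_
    refine (hsum n _ ((((n : ℝ) + 1) ^ σ / κ) ^ (k + 1)) (by positivity) fun Λ hΛ => ?_).trans ?_
    · rw [norm_div, norm_pow, norm_neg, norm_one, one_pow, norm_pow, one_div, ← inv_pow]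
      exact pow_le_pow_left₀ (by positivity) (hlinv n Λ hΛ) _
    · calc _ = C * (κ⁻¹) ^ (k + 1) *
            (((n : ℝ) + 1) ^ (σ * k + (σ + 1)) * Real.exp (-(n : ℝ) / 2)) := by
            rw [div_eq_mul_inv, mul_pow, ← pow_mul]; ring
        _ ≤ C * (κ⁻¹) ^ (k + 1) * _ :=
            mul_le_mul_of_nonneg_left (moment_le σ (σ + 1) k n) (by positivity)
        _ = _ := by ring
  · have e : (∑ Λ ∈ T n, (q - Λ)⁻¹) • v n - ∑ k ∈ Finset.range N,
        (q - l) ^ k • ((∑ Λ ∈ T n, (-1) ^ k / (l - Λ) ^ (k + 1)) • v n) =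
        (∑ Λ ∈ T n, (q - l) ^ N * ((-1) ^ N / (l - Λ) ^ N) * (q - Λ)⁻¹) • v n := by
      simp only [smul_smul]
      rw [← Finset.sum_smul, ← sub_smul]
      congr 1
      simp only [Finset.mul_sum]
      rw [Finset.sum_comm, ← Finset.sum_sub_distrib]
      refine Finset.sum_congr rfl fun Λ hΛ => inv_sub_expansion ?_ ?_ N
      · exact sub_ne_zero.1 (norm_pos_iff.1 (hlpos n Λ hΛ))
      · exact sub_ne_zero.1 (norm_pos_iff.1 (hqpos n Λ hΛ q hqs))
    rw [e]
    refine (hsum n _ (‖q - l‖ ^ N * (((n : ℝ) + 1) ^ σ / κ) ^ (N + 2) * c⁻¹) (by positivity)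
      fun Λ hΛ => ?_).trans ?_
    · have hp := hlpos n Λ hΛ
      have h2 : ‖q - Λ‖⁻¹ ≤ c⁻¹ * (‖l - Λ‖⁻¹) ^ 2 := by
        rw [inv_pow, ← mul_inv]
        exact inv_anti₀ (by positivity) (hq n Λ hΛ q hqs)
      rw [norm_mul, norm_mul, norm_div, norm_pow, norm_pow, norm_neg, norm_one, one_pow, norm_pow,
        norm_inv, one_div, ← inv_pow]
      calc _ ≤ ‖q - l‖ ^ N * (‖l - Λ‖⁻¹) ^ N * (c⁻¹ * (‖l - Λ‖⁻¹) ^ 2) := by gcongr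
        _ = ‖q - l‖ ^ N * (‖l - Λ‖⁻¹) ^ (N + 2) * c⁻¹ := by ring
        _ ≤ _ := by gcongr; exact hlinv n Λ hΛ
    · rw [gamma_one_add_mul_natCast]
      calc _ = C * c⁻¹ * (κ⁻¹) ^ (N + 2) * ‖q - l‖ ^ N *
            (((n : ℝ) + 1) ^ (σ * N + (2 * σ + 1)) * Real.exp (-(n : ℝ) / 2)) := by
            rw [div_eq_mul_inv, mul_pow, ← pow_mul]; ring
        _ ≤ C * c⁻¹ * (κ⁻¹) ^ (N + 2) * ‖q - l‖ ^ N * _ :=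
            mul_le_mul_of_nonneg_left (moment_le σ (2 * σ + 1) N n) (by positivity)
        _ = _ := by rw [mul_pow, pow_add]; ring

end Series

/-- Restores a simple pole of residue `c` at `l` after multiplication by `q - l`. Orders shift by
one, which costs the factor `1 / c₁`; order `0` is covered by `‖c‖ + M c₀`. -/
theorem HasGevreyExpansionOn.const_add_mul {σ : ℕ} {l : ℂ} {s : Set ℂ} {f : ℂ → ℂ} {a : ℕ → ℂ}
    (hf : HasGevreyExpansionOn σ l s f a) {M : ℝ} (hM : 0 ≤ M) (hs : ∀ q ∈ s, ‖q - l‖ ≤ M) (c : ℂ) :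
    ∃ b, HasGevreyExpansionOn σ l s (fun q => c + (q - l) * f q) b := by
  obtain ⟨hd, c₀, h0, c₁, h1, hb⟩ := hf
  refine ⟨fun n => Nat.casesOn n c a, by fun_prop, ‖c‖ + M * c₀ + c₀ / c₁, by positivity, c₁, h1,
    fun N q hq => ?_⟩
  rw [gamma_one_add_mul_natCast]
  rcases N with _ | N
  · have h := hb 0 q hq
    simp at h
    simp only [Finset.range_zero, Finset.sum_empty, sub_zero, pow_zero, mul_one, mul_zero,
      Nat.factorial_zero, Nat.cast_one]
    have h2 : ‖q - l‖ * ‖f q‖ ≤ M * c₀ := mul_le_mul (hs q hq) h (norm_nonneg _) hM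
    calc _ ≤ ‖c‖ + ‖(q - l) * f q‖ := norm_add_le _ _
      _ ≤ _ := by rw [norm_mul]; have : 0 < c₀ / c₁ := by positivity
                  linarith
  · have h := hb N q hq
    rw [gamma_one_add_mul_natCast] at h
    have e : c + (q - l) * f q - ∑ n ∈ Finset.range (N + 1),
        (q - l) ^ n • (Nat.casesOn n c a : ℂ) =
        (q - l) * (f q - ∑ n ∈ Finset.range N, (q - l) ^ n • a n) := by
      have e' : ∑ n ∈ Finset.range N, (q - l) ^ (n + 1) * a n =
          (q - l) * ∑ n ∈ Finset.range N, (q - l) ^ n * a n := by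
        rw [Finset.mul_sum]
        exact Finset.sum_congr rfl fun n _ => by ring
      rw [Finset.sum_range_succ']
      simp only [smul_eq_mul]
      rw [e']
      change _ - (_ + (q - l) ^ 0 * c) = _
      ring
    rw [e, norm_mul]
    have hfac : ((σ * N).factorial : ℝ) ≤ (σ * (N + 1)).factorial := by
      exact_mod_cast Nat.factorial_le (Nat.mul_le_mul_left σ N.le_succ)
    calc _ ≤ ‖q - l‖ * (c₀ * c₁ ^ N * (σ * N).factorial * ‖q - l‖ ^ N) := by gcongr
      _ ≤ ‖q - l‖ * (c₀ * c₁ ^ N * (σ * (N + 1)).factorial * ‖q - l‖ ^ N) := by gcongr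
      _ = c₀ / c₁ * c₁ ^ (N + 1) * (σ * (N + 1)).factorial * ‖q - l‖ ^ (N + 1) := by
          field_simp
          ring
      _ ≤ _ := by
          gcongr
          have : 0 ≤ ‖c‖ + M * c₀ := by positivity
          linarith

/-! ### Distances to roots of unity -/

/-- The distance from `Λ` to the disk is at least `|Λ - c| - ρ = (|Λ - c|^2 - ρ^2) / (|Λ - c| + ρ)`.
-/
theorem norm_sub_ge_of_sq_ge {q Λ c : ℂ} {ρ K d : ℝ} (hρ : 0 < ρ) (hd : 0 ≤ d) (hK : 0 < K)
    (hq : ‖q - c‖ ≤ ρ) (h1 : ρ ^ 2 + d ≤ ‖Λ - c‖ ^ 2) (h2 : ‖Λ - c‖ + ρ ≤ K) :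
    d / K ≤ ‖q - Λ‖ := by
  have h3 : ‖Λ - c‖ - ρ ≤ ‖q - Λ‖ := by
    have := norm_sub_le_norm_sub_add_norm_sub Λ q c
    rw [norm_sub_rev Λ q] at this
    linarith
  have h4 : ρ ≤ ‖Λ - c‖ := by nlinarith [norm_nonneg (Λ - c)]
  refine le_trans ?_ h3
  rw [div_le_iff₀ hK]
  nlinarith

theorem sq_norm_sub_tangent_center {l Λ : ℂ} (hl : ‖l‖ = 1) (hΛ : ‖Λ‖ = 1) {κ ρ : ℝ}
    (hκ : κ ^ 2 = 1) :
    ‖Λ - (1 + κ * ρ) * l‖ ^ 2 = ρ ^ 2 + (1 + κ * ρ) * ‖l - Λ‖ ^ 2 := by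
  have h1 : l.re * l.re + l.im * l.im = 1 := by
    rw [← Complex.normSq_apply, ← Complex.sq_norm, hl, one_pow]
  have h2 : Λ.re * Λ.re + Λ.im * Λ.im = 1 := by
    rw [← Complex.normSq_apply, ← Complex.sq_norm, hΛ, one_pow]
  have e : (1 + κ * ρ) * l = ((1 + κ * ρ : ℝ) : ℂ) * l := by push_cast; ring
  rw [e, Complex.sq_norm, Complex.sq_norm, Complex.normSq_apply, Complex.normSq_apply]
  simp only [Complex.sub_re, Complex.sub_im, Complex.re_ofReal_mul, Complex.im_ofReal_mul]
  linear_combination (κ ^ 2 * ρ ^ 2 + κ * ρ) * h1 - κ * ρ * h2 + ρ ^ 2 * hκ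

/-- The unit circle leaves a tangent disk quadratically; the inner disk gives the worse constant `1
- ρ`. -/
theorem norm_sub_ge_of_mem_tangentDisks {l Λ q : ℂ} (hl : ‖l‖ = 1) (hΛ : ‖Λ‖ = 1) {ρ : ℝ}
    (hρ : ρ ∈ Set.Ioo (0 : ℝ) 1) (hq : q ∈ tangentDisks l ρ) :
    (1 - ρ) / 4 * ‖l - Λ‖ ^ 2 ≤ ‖q - Λ‖ := by
  have key : ∀ κ : ℝ, κ ^ 2 = 1 → |κ| = 1 → ‖q - (1 + κ * ρ) * l‖ < ρ →
      (1 - ρ) / 4 * ‖l - Λ‖ ^ 2 ≤ ‖q - Λ‖ := by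
    intro κ hκ hκ' hq
    have hκρ : -ρ ≤ κ * ρ := by
      have := neg_abs_le κ
      nlinarith [hρ.1]
    have hκρ' : κ * ρ ≤ ρ := by
      have := le_abs_self κ
      nlinarith [hρ.1]
    have := norm_sub_ge_of_sq_ge (K := 4) (d := (1 - ρ) * ‖l - Λ‖ ^ 2) hρ.1
      (by have := hρ.2; have : 0 ≤ 1 - ρ := by linarith
          positivity) (by norm_num) hq.le (by
        rw [sq_norm_sub_tangent_center hl hΛ hκ]
        have : 0 ≤ ‖l - Λ‖ ^ 2 := by positivity
        nlinarith) (by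
        have h1 : ‖Λ - (1 + κ * ρ) * l‖ ≤ ‖Λ‖ + ‖(1 + (κ : ℂ) * ρ) * l‖ := norm_sub_le _ _
        have h2 : ‖(1 + (κ : ℂ) * ρ) * l‖ = 1 + κ * ρ := by
          rw [norm_mul, hl, mul_one, ← Complex.ofReal_mul, ← Complex.ofReal_one,
            ← Complex.ofReal_add, Complex.norm_real, Real.norm_eq_abs,
            abs_of_nonneg (by linarith [hρ.2])]
        rw [hΛ, h2] at h1
        linarith [hρ.2])
    linarith
  rcases hq with hq | hq
  · refine key (-1) (by norm_num) (by norm_num) ?_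
    rw [mem_ball, dist_eq_norm] at hq
    simpa [sub_eq_add_neg] using hq
  · refine key 1 (by norm_num) (by norm_num) ?_
    rw [mem_ball, dist_eq_norm] at hq
    simpa using hq

/-- Write `V = v^2` and `w^2 - V = (w - v)(w + v)`. With `d = |v|^2`, the hypotheses force `|Re v| ≤
d/2`: near the origin `±v` approach along the tangent to the disk. So `|±v - ρ|^2 - ρ^2 ≥ d/2`, and
each factor is at least `d/6`. -/
theorem norm_sq_sub_ge {ρ : ℝ} (hρ : 0 < ρ) (hρ' : ρ ≤ 1 / 2) {w V : ℂ} (hw : w ∈ ball (ρ : ℂ) ρ)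
    (hre : V.re ≤ 0) (hsq : ‖V‖ ^ 2 = 2 * |V.im|) (hV : ‖V‖ ≤ 2) :
    1 / 36 * ‖V‖ ^ 2 ≤ ‖w ^ 2 - V‖ := by
  obtain ⟨v, rfl⟩ := IsAlgClosed.exists_pow_nat_eq V two_pos
  rw [norm_pow] at hV hsq ⊢
  set d := ‖v‖ ^ 2 with hd
  have hd0 : 0 ≤ d := by positivity
  have hdab : d = v.re ^ 2 + v.im ^ 2 := by
    rw [hd, Complex.sq_norm, Complex.normSq_apply]; ring
  have hre' : v.re ^ 2 ≤ v.im ^ 2 := by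
    rw [pow_two, Complex.mul_re] at hre; nlinarith
  have him : |(v ^ 2).im| = 2 * (|v.re| * |v.im|) := by
    rw [pow_two, Complex.mul_im, ← abs_mul,
      show v.re * v.im + v.im * v.re = 2 * (v.re * v.im) by ring, abs_mul 2,
      abs_of_pos (zero_lt_two' ℝ)]
  rw [him] at hsq
  have ha : |v.re| ≤ d / 2 := by
    have h4 : d ^ 4 = 16 * (v.re ^ 2 * v.im ^ 2) := by
      rw [← sq_abs v.re, ← sq_abs v.im]
      calc d ^ 4 = (d ^ 2) ^ 2 := by ring
        _ = _ := by rw [hsq]; ring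
    rcases hd0.eq_or_lt with h | h
    · rw [← h] at hdab
      have : v.re ^ 2 = 0 := by nlinarith [sq_nonneg v.re, sq_nonneg v.im]
      rw [pow_eq_zero_iff two_ne_zero] at this
      rw [this, abs_zero, ← h]; norm_num
    · have h5 : v.re ^ 2 * 8 * d ≤ d ^ 4 := by
        rw [h4]; nlinarith [sq_nonneg v.re]
      have h6 : v.re ^ 2 * 8 ≤ d ^ 3 := by
        have : v.re ^ 2 * 8 * d ≤ d ^ 3 * d := by linarith
        exact le_of_mul_le_mul_right this h
      apply abs_le_of_sq_le_sq _ (by positivity)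
      nlinarith [sq_nonneg d]
  have hv2 : ‖v‖ ≤ 3 / 2 := by
    rw [hd] at hV
    nlinarith [norm_nonneg v]
  have key : ∀ v' : ℂ, ‖v'‖ = ‖v‖ → |v'.re| = |v.re| → d / 2 / 3 ≤ ‖w - v'‖ := by
    intro v' hn hr
    refine norm_sub_ge_of_sq_ge (c := ρ) hρ (by positivity) (by norm_num)
      (by rw [← dist_eq_norm]; exact (mem_ball.1 hw).le) ?_ ?_
    · have h1 : ‖v' - ρ‖ ^ 2 = ‖v'‖ ^ 2 - 2 * ρ * v'.re + ρ ^ 2 := by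
        rw [Complex.sq_norm, Complex.sq_norm, Complex.normSq_apply, Complex.normSq_apply]
        simp only [Complex.sub_re, Complex.ofReal_re, Complex.sub_im, Complex.ofReal_im, sub_zero]
        ring
      rw [h1, hn, ← hd]
      have h2 : v'.re ≤ d / 2 := (le_abs_self _).trans (hr ▸ ha)
      nlinarith
    · have h1 : ‖v' - ρ‖ ≤ ‖v'‖ + ‖(ρ : ℂ)‖ := norm_sub_le _ _
      rw [hn, Complex.norm_real, Real.norm_eq_abs, abs_of_pos hρ] at h1
      linarith
  have h1 := key v rfl rfl
  have h2 := key (-v) (norm_neg v) (by simp)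
  have e : w ^ 2 - v ^ 2 = (w - v) * (w - -v) := by ring
  rw [e, norm_mul]
  calc _ = (d / 2 / 3) * (d / 2 / 3) := by ring
    _ ≤ _ := mul_le_mul h1 h2 (by positivity) (norm_nonneg _)

theorem norm_sub_ge_of_mem_cardioid {J l Λ q : ℂ} (hJ : J = Complex.I ∨ J = -Complex.I)
    (hl : ‖l‖ = 1) (hΛ : ‖Λ‖ = 1) (hre : ((Λ / l - 1) / J).re ≤ 0) {ρ : ℝ} (hρ : 0 < ρ)
    (hρ' : ρ ≤ 1 / 2) (hq : q ∈ cardioid J l ρ) : 1 / 36 * ‖l - Λ‖ ^ 2 ≤ ‖q - Λ‖ := by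
  have hl0 : l ≠ 0 := norm_pos_iff.1 (by rw [hl]; exact one_pos)
  have hJ1 := norm_of_eq_I_or_neg_I hJ
  have hJ0 : J ≠ 0 := norm_pos_iff.1 (by rw [hJ1]; exact one_pos)
  obtain ⟨w, hw, rfl⟩ := mem_cardioid_iff.1 hq
  set V := (Λ / l - 1) / J with hV
  have hΛV : Λ = l * (1 + J * V) := by rw [hV]; field_simp; ring
  have hn : ‖l - Λ‖ = ‖V‖ := by
    rw [hΛV, show l - l * (1 + J * V) = -(l * J * V) by ring, norm_neg, norm_mul, norm_mul, hl, hJ1,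
      one_mul, one_mul]
  have hn2 : ‖l * (1 + J * w ^ 2) - Λ‖ = ‖w ^ 2 - V‖ := by
    rw [hΛV, show l * (1 + J * w ^ 2) - l * (1 + J * V) = l * J * (w ^ 2 - V) by ring, norm_mul,
      norm_mul, hl, hJ1, one_mul, one_mul]
  rw [hn, hn2]
  refine norm_sq_sub_ge hρ hρ' hw hre ?_ ?_
  -- In the coordinate `V` the unit circle is `|1 + J V| = 1`, that is `|V|^2 = ±2 Im V`.
  · have h1 : ‖1 + J * V‖ = 1 := by
      have := hΛ
      rw [hΛV, norm_mul, hl, one_mul] at this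
      exact this
    have h2 : Complex.normSq (1 + J * V) = 1 := by rw [← Complex.sq_norm, h1, one_pow]
    rw [Complex.normSq_apply] at h2
    rw [Complex.sq_norm, Complex.normSq_apply]
    have hge : 0 ≤ V.re * V.re + V.im * V.im :=
      add_nonneg (mul_self_nonneg _) (mul_self_nonneg _)
    rcases hJ with h | h <;> rw [h] at h2 <;> simp at h2
    · rw [abs_of_nonneg (by nlinarith)]; nlinarith
    · rw [abs_of_nonpos (by nlinarith)]; nlinarith
  · rw [← hn]
    calc _ ≤ ‖l‖ + ‖Λ‖ := norm_sub_le _ _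
      _ = 2 := by rw [hl, hΛ]; norm_num

theorem norm_sub_le_of_mem_cardioid {J l q : ℂ} (hJ : ‖J‖ = 1) (hl : ‖l‖ = 1) {ρ : ℝ}
    (hq : q ∈ cardioid J l ρ) : ‖q - l‖ ≤ 4 * ρ ^ 2 := by
  obtain ⟨w, hw, rfl⟩ := mem_cardioid_iff.1 hq
  rw [mem_ball, dist_eq_norm] at hw
  have hρ : 0 < ρ := (norm_nonneg _).trans_lt hw
  have h1 : ‖w‖ ≤ 2 * ρ := by
    have := norm_le_norm_add_norm_sub' w (ρ : ℂ)
    rw [Complex.norm_real, Real.norm_eq_abs, abs_of_pos hρ] at this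
    linarith
  rw [show l * (1 + J * w ^ 2) - l = l * J * w ^ 2 by ring, norm_mul, norm_mul, hl, hJ, one_mul,
    one_mul, norm_pow]
  calc _ ≤ (2 * ρ) ^ 2 := by gcongr
    _ = _ := by ring

/-- The real part of `(e^(iθ) - 1)/i` is `sin θ`, and here `θ` lies between `-π` and `0`. -/
theorem re_nonpos_of_mem_arcLT {l Λ : ℂ} (hl : ‖l‖ = 1) (h : Λ ∈ arcLT l) :
    ((Λ / l - 1) / Complex.I).re ≤ 0 := by
  have hl0 : l ≠ 0 := norm_pos_iff.1 (by rw [hl]; exact one_pos)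
  obtain ⟨t, ht, rfl⟩ := h
  rw [mul_div_cancel_left₀ _ hl0, Complex.div_I,
    show 2 * (Real.pi : ℂ) * Complex.I * t = ((2 * Real.pi * t : ℝ) : ℂ) * Complex.I by
      push_cast; ring]
  simp only [Complex.neg_re, Complex.mul_re, Complex.I_re, Complex.I_im, Complex.sub_im,
    Complex.exp_ofReal_mul_I_im, Complex.one_im, sub_zero, mul_zero, mul_one, zero_sub, neg_neg]
  apply Real.sin_nonpos_of_nonpos_of_neg_pi_le
  · nlinarith [ht.2, Real.pi_pos]
  · nlinarith [ht.1, Real.pi_pos]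

theorem re_nonpos_of_mem_arcGT {l Λ : ℂ} (hl : ‖l‖ = 1) (h : Λ ∈ arcGT l) :
    ((Λ / l - 1) / -Complex.I).re ≤ 0 := by
  have hl0 : l ≠ 0 := norm_pos_iff.1 (by rw [hl]; exact one_pos)
  obtain ⟨t, ht, rfl⟩ := h
  rw [mul_div_cancel_left₀ _ hl0, div_neg, Complex.div_I,
    show 2 * (Real.pi : ℂ) * Complex.I * t = ((2 * Real.pi * t : ℝ) : ℂ) * Complex.I by
      push_cast; ring]
  simp only [Complex.mul_re, Complex.I_re, Complex.I_im, Complex.sub_im,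
    Complex.exp_ofReal_mul_I_im, Complex.one_im, sub_zero, mul_zero, mul_one, zero_sub, neg_neg]
  rw [neg_nonpos]
  apply Real.sin_nonneg_of_nonneg_of_le_pi
  · nlinarith [ht.1, Real.pi_pos]
  · nlinarith [ht.2, Real.pi_pos]

/-- The chord has length `2 |sin πt|` with `|t| ≤ 1/2`, and Jordan's inequality bounds it below by
`4 |t|`. -/
theorem four_mul_abs_sub_round_le (x : ℝ) :
    4 * |x - round x| ≤ ‖Complex.exp (2 * Real.pi * Complex.I * x) - 1‖ := by
  have h1 := abs_sub_round x
  set t := x - round x with ht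
  have e : Complex.exp (2 * Real.pi * Complex.I * x) =
      Complex.exp (Complex.I * ((2 * Real.pi * t : ℝ) : ℂ)) := by
    rw [Complex.exp_eq_exp_iff_exists_int]
    refine ⟨round x, ?_⟩
    rw [ht]; push_cast; ring
  rw [e, Complex.norm_exp_I_mul_ofReal_sub_one, norm_mul, Real.norm_eq_abs, Real.norm_eq_abs,
    abs_of_pos (zero_lt_two' ℝ), show 2 * Real.pi * t / 2 = Real.pi * t by ring]
  have h2 : |Real.pi * t| = Real.pi * |t| := by rw [abs_mul, abs_of_pos Real.pi_pos]
  have h3 := Real.mul_abs_le_abs_sin (x := Real.pi * t) (by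
    rw [h2]; nlinarith [Real.pi_pos])
  rw [h2] at h3
  have h4 : 2 / Real.pi * (Real.pi * |t|) = 2 * |t| := by
    field_simp
  linarith

theorem exists_exp_of_pow_eq_one {m : ℕ} (hm : 0 < m) {Λ : ℂ} (hΛ : Λ ^ m = 1) :
    ∃ j : ℕ, Λ = Complex.exp (2 * Real.pi * Complex.I * ((j / m : ℝ) : ℂ)) := by
  have : NeZero m := ⟨hm.ne'⟩
  obtain ⟨j, -, hj⟩ := (Complex.isPrimitiveRoot_exp m hm.ne').eq_pow_of_pow_eq_one hΛ
  refine ⟨j, ?_⟩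
  rw [← hj, ← Complex.exp_nat_mul]
  congr 1; push_cast; ring

theorem exists_norm_sub_ge_of_diophantine {l : ℂ} (hl : l ∈ diophantinePoints 2) :
    ∃ κ : ℝ, 0 < κ ∧ ∀ n : ℕ, ∀ Λ : ℂ, Λ ^ (n + 1) = 1 → κ / ((n : ℝ) + 1) ^ 2 ≤ ‖l - Λ‖ := by
  obtain ⟨γ, hγ, y, ⟨-, hy⟩, rfl⟩ := hl
  refine ⟨4 * γ, by positivity, fun n Λ hΛ => ?_⟩
  obtain ⟨j, rfl⟩ := exists_exp_of_pow_eq_one n.succ_pos hΛ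
  have hn : ((n + 1 : ℕ) : ℝ) ≠ 0 := by positivity
  set x : ℝ := y - (j : ℝ) / ((n + 1 : ℕ) : ℝ) with hx
  have e : Complex.exp (2 * Real.pi * Complex.I * y) -
      Complex.exp (2 * Real.pi * Complex.I * (((j : ℝ) / ((n + 1 : ℕ) : ℝ) : ℝ) : ℂ)) =
      Complex.exp (2 * Real.pi * Complex.I * (((j : ℝ) / ((n + 1 : ℕ) : ℝ) : ℝ) : ℂ)) *
      (Complex.exp (2 * Real.pi * Complex.I * x) - 1) := by
    rw [mul_sub, ← Complex.exp_add, mul_one, hx]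
    congr 2; push_cast; ring
  rw [e, norm_mul, show 2 * (Real.pi : ℂ) * Complex.I * (((j : ℝ) / ((n + 1 : ℕ) : ℝ) : ℝ) : ℂ) =
    ((2 * Real.pi * ((j : ℝ) / ((n + 1 : ℕ) : ℝ)) : ℝ) : ℂ) * Complex.I by push_cast; ring,
    Complex.norm_exp_ofReal_mul_I, one_mul]
  refine le_trans ?_ (four_mul_abs_sub_round_le x)
  -- The rounding integer is absorbed into the numerator, since the Diophantine condition ranges
  -- over all integers.
  have h := hy (j + round x * (n + 1 : ℕ)) (n + 1) (by omega)
  have e2 : y - ((j + round x * (n + 1 : ℕ) : ℤ) : ℝ) / ((n + 1 : ℕ) : ℝ) = x - round x := by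
    rw [hx]; push_cast; field_simp; ring
  rw [e2, show (-2 : ℝ) = -((2 : ℕ) : ℝ) by norm_num, Real.rpow_neg (by positivity),
    Real.rpow_natCast] at h
  push_cast at h
  rw [mul_div_assoc, div_eq_mul_inv]
  linarith

/-- The ratio `Λ / Λ₀` is an `Mn`-th root of unity other than `1`, so its angle is at least `1/(Mn)`
turns from an integer. -/
theorem norm_sub_ge_of_pow_eq_one {M n : ℕ} (hM : 0 < M) (hn : 0 < n) {Λ₀ Λ : ℂ} (h₀ : Λ₀ ^ M = 1)
    (hΛ : Λ ^ n = 1) (hne : Λ ≠ Λ₀) : 4 / (M * n : ℝ) ≤ ‖Λ₀ - Λ‖ := by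
  have h0 : Λ₀ ≠ 0 := by rintro rfl; simp [hM.ne'] at h₀
  have hn0 : ‖Λ₀‖ = 1 := Complex.norm_eq_one_of_pow_eq_one h₀ hM.ne'
  have hpow : (Λ / Λ₀) ^ (M * n) = 1 := by
    rw [div_pow, pow_mul Λ₀, h₀, one_pow, mul_comm, pow_mul, hΛ, one_pow, div_one]
  obtain ⟨j, hj⟩ := exists_exp_of_pow_eq_one (Nat.mul_pos hM hn) hpow
  set x : ℝ := (j : ℝ) / ((M * n : ℕ) : ℝ) with hx
  have hMn : (0 : ℝ) < ((M * n : ℕ) : ℝ) := by exact_mod_cast Nat.mul_pos hM hn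
  have e : ‖Λ₀ - Λ‖ = ‖Λ / Λ₀ - 1‖ := by
    rw [norm_sub_rev, show Λ - Λ₀ = Λ₀ * (Λ / Λ₀ - 1) by field_simp, norm_mul, hn0, one_mul]
  rw [e, hj]
  refine le_trans ?_ (four_mul_abs_sub_round_le x)
  have e2 : x - round x = ((j - round x * (M * n : ℕ) : ℤ) : ℝ) / ((M * n : ℕ) : ℝ) := by
    rw [hx]; push_cast; field_simp
  have hz : (j - round x * (M * n : ℕ) : ℤ) ≠ 0 := by
    intro hz
    rw [hz, Int.cast_zero, zero_div, sub_eq_zero] at e2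
    apply hne
    rw [e2] at hj
    have : Complex.exp (2 * Real.pi * Complex.I * ((round x : ℝ) : ℂ)) = 1 := by
      rw [Complex.exp_eq_one_iff]
      exact ⟨round x, by push_cast; ring⟩
    rw [this, div_eq_one_iff_eq h0] at hj
    exact hj
  rw [e2, abs_div, abs_of_pos hMn, ← mul_div_assoc]
  have h1 : (1 : ℝ) ≤ |((j - round x * (M * n : ℕ) : ℤ) : ℝ)| := by
    rw [← Int.cast_abs]
    exact_mod_cast Int.one_le_abs hz
  rw [← Nat.cast_mul]
  gcongr
  linarith

/-! ### Möbius inversion -/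

theorem tsum_tsum_eq_tsum_divisorsAntidiagonal {F : ℕ → ℕ → ℂ}
    (hF : Summable fun p : ℕ+ × ℕ+ => F p.1 p.2) :
    ∑' a : ℕ+, ∑' b : ℕ+, F a b =
      ∑' n : ℕ+, ∑ x ∈ (n : ℕ).divisorsAntidiagonal, F x.1 x.2 := by
  rw [← hF.tsum_prod (f := fun p : ℕ+ × ℕ+ => F p.1 p.2), ← sigmaAntidiagonalEquivProd.tsum_eq]
  refine (Summable.tsum_sigma (sigmaAntidiagonalEquivProd.summable_iff.2 hF)).trans ?_
  refine tsum_congr fun n => ?_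
  rw [← Finset.tsum_subtype]
  rfl

theorem norm_gammelCoeff_le (m : ℕ) : ‖gammelCoeff m‖ ≤ Real.exp (-(m : ℝ)) := by
  unfold gammelCoeff
  split_ifs
  · rw [Complex.norm_exp]
    simp
  · rw [norm_zero]; positivity

theorem norm_moebius_le_one (j : ℕ) : ‖((ArithmeticFunction.moebius j : ℤ) : ℂ)‖ ≤ 1 := by
  rw [Complex.norm_intCast, ← Int.cast_abs]
  exact_mod_cast ArithmeticFunction.abs_moebius_le_one

/-- The Möbius transform `∑ μ(j) A_{nj}` of the coefficients of `G`: the residue of the `z^n` term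
of the regularised solution at each `n`-th root of unity. -/
def residue (n : ℕ) : ℂ :=
  ∑' j : ℕ, ((ArithmeticFunction.moebius j : ℤ) : ℂ) * gammelCoeff (n * j)

theorem exp_neg_mul_eq (n j : ℕ) : Real.exp (-((n * j : ℕ) : ℝ)) = Real.exp (-(n : ℝ)) ^ j := by
  rw [← Real.exp_nat_mul]; push_cast; congr 1; ring

theorem norm_residue_term_le (n j : ℕ) :
    ‖((ArithmeticFunction.moebius j : ℤ) : ℂ) * gammelCoeff (n * j)‖ ≤
      Real.exp (-(n : ℝ)) ^ j := by
  rw [norm_mul, ← exp_neg_mul_eq]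
  calc _ ≤ 1 * Real.exp (-((n * j : ℕ) : ℝ)) :=
        mul_le_mul (norm_moebius_le_one j) (norm_gammelCoeff_le _) (norm_nonneg _) zero_le_one
    _ = _ := one_mul _

theorem exp_neg_natCast_le_half {n : ℕ} (hn : 0 < n) : Real.exp (-(n : ℝ)) ≤ 1 / 2 := by
  have h1 : Real.exp (-(n : ℝ)) ≤ Real.exp (-1) := by
    apply Real.exp_le_exp.2
    have : (1 : ℝ) ≤ n := by exact_mod_cast hn
    linarith
  refine h1.trans ?_
  rw [Real.exp_neg, one_div]
  exact inv_anti₀ two_pos (by linarith [Real.add_one_le_exp (1 : ℝ)])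

theorem summable_residue {n : ℕ} (hn : 0 < n) :
    Summable fun j : ℕ => ((ArithmeticFunction.moebius j : ℤ) : ℂ) * gammelCoeff (n * j) := by
  have h := exp_neg_natCast_le_half hn
  exact (summable_geometric_of_lt_one (by positivity) (by linarith)).of_norm_bounded
    (norm_residue_term_le n)

theorem norm_residue_le {n : ℕ} (hn : 0 < n) : ‖residue n‖ ≤ 2 * Real.exp (-(n : ℝ)) := by
  have h := exp_neg_natCast_le_half hn
  set x := Real.exp (-(n : ℝ)) with hx
  have hx0 : 0 < x := Real.exp_pos _
  have hs := (summable_residue hn)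
  -- The term `j = 0` vanishes because `μ(0) = 0`; what remains is bounded by `x/(1 - x) ≤ 2x` with
  -- `x = e^(-n) ≤ 1/2`.
  rw [residue, hs.tsum_eq_zero_add]
  simp only [ArithmeticFunction.map_zero, Int.cast_zero, zero_mul, zero_add]
  have hg := (hasSum_geometric_of_lt_one (r := x) (by positivity) (by linarith)).mul_left x
  refine (tsum_of_norm_bounded hg fun j => ?_).trans ?_
  · rw [← pow_succ']
    exact norm_residue_term_le n (j + 1)
  · rw [← div_eq_mul_inv, div_le_iff₀ (by linarith)]
    nlinarith

theorem sum_moebius_snd {n : ℕ} :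
    ∑ x ∈ n.divisorsAntidiagonal, ((ArithmeticFunction.moebius x.2 : ℤ) : ℂ) =
      if n = 1 then 1 else 0 := by
  rw [Nat.sum_divisorsAntidiagonal' (f := fun _ j => ((ArithmeticFunction.moebius j : ℤ) : ℂ)),
    ← Int.cast_sum, ← ArithmeticFunction.coe_mul_zeta_apply,
    ArithmeticFunction.moebius_mul_coe_zeta, ArithmeticFunction.one_apply]
  split_ifs <;> simp

theorem exp_neg_one_lt_one : ‖Real.exp (-1)‖ < 1 := by
  rw [Real.norm_eq_abs, Real.abs_exp, Real.exp_lt_one_iff]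
  norm_num

theorem exp_neg_one_pow (m : ℕ) : Real.exp (-1) ^ m = Real.exp (-(m : ℝ)) := by
  rw [← Real.exp_nat_mul]; congr 1; ring

/-- Möbius inversion along multiples: collecting `∑_b ∑_j μ(j) A_{abj}` by `n = bj` leaves `∑_n
A_{an} ∑_{j ∣ n} μ(j)`, in which only `n = 1` contributes. -/
theorem tsum_pnat_residue {a : ℕ} (ha : 0 < a) :
    ∑' b : ℕ+, residue (a * b) = gammelCoeff a := by
  have h1 : ∀ b : ℕ+, residue (a * b) = ∑' j : ℕ+,
      ((ArithmeticFunction.moebius j : ℤ) : ℂ) * gammelCoeff (a * (b * j)) := by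
    intro b
    rw [residue, (summable_residue (Nat.mul_pos ha b.pos)).tsum_eq_zero_add,
      tsum_pnat_eq_tsum_succ (f := fun j =>
        ((ArithmeticFunction.moebius j : ℤ) : ℂ) * gammelCoeff (a * (b * j)))]
    simp only [ArithmeticFunction.map_zero, Int.cast_zero, zero_mul, zero_add, mul_assoc]
  simp only [h1]
  rw [tsum_tsum_eq_tsum_divisorsAntidiagonal (F := fun b j =>
    ((ArithmeticFunction.moebius j : ℤ) : ℂ) * gammelCoeff (a * (b * j)))]
  · have h2 : ∀ n : ℕ+, ∑ x ∈ (n : ℕ).divisorsAntidiagonal,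
        ((ArithmeticFunction.moebius x.2 : ℤ) : ℂ) * gammelCoeff (a * (x.1 * x.2)) =
        if n = 1 then gammelCoeff a else 0 := by
      intro n
      have : ∀ x ∈ (n : ℕ).divisorsAntidiagonal,
          ((ArithmeticFunction.moebius x.2 : ℤ) : ℂ) * gammelCoeff (a * (x.1 * x.2)) =
          ((ArithmeticFunction.moebius x.2 : ℤ) : ℂ) * gammelCoeff (a * n) := fun x hx => by
        rw [(Nat.mem_divisorsAntidiagonal.1 hx).1]
      rw [Finset.sum_congr rfl this, ← Finset.sum_mul, sum_moebius_snd]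
      by_cases hn : n = 1
      · simp [hn]
      · rw [if_neg hn, if_neg (by simpa using hn), zero_mul]
    simp only [h2]
    rw [tsum_ite_eq]
  · have hs := summable_prod_mul_pow 0 exp_neg_one_lt_one
    refine hs.of_norm_bounded fun p => ?_
    rw [pow_zero, one_mul, exp_neg_one_pow, norm_mul]
    calc _ ≤ 1 * Real.exp (-((a * (p.1 * p.2) : ℕ) : ℝ)) :=
          mul_le_mul (norm_moebius_le_one _) (norm_gammelCoeff_le _) (norm_nonneg _) zero_le_one
      _ ≤ _ := by
        rw [one_mul]
        apply Real.exp_le_exp.2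
        rw [neg_le_neg_iff, Nat.cast_le]
        exact Nat.le_mul_of_pos_left _ ha

/-! ### Sums of simple poles at roots of unity -/

theorem norm_eq_one_of_mem_nthRootsFinset {n : ℕ} (hn : 0 < n) {Λ : ℂ}
    (h : Λ ∈ Polynomial.nthRootsFinset n (1 : ℂ)) : ‖Λ‖ = 1 :=
  Complex.norm_eq_one_of_pow_eq_one ((Polynomial.mem_nthRootsFinset hn 1).1 h) hn.ne'

theorem card_nthRootsFinset_le (n : ℕ) : (Polynomial.nthRootsFinset n (1 : ℂ)).card ≤ n := by
  rcases Nat.eq_zero_or_pos n with rfl | hn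
  · simp
  · rw [(Complex.isPrimitiveRoot_exp n hn.ne').card_nthRootsFinset]

theorem primitiveRoots_subset_nthRootsFinset (n : ℕ) :
    primitiveRoots n ℂ ⊆ Polynomial.nthRootsFinset n (1 : ℂ) := by
  intro Λ h
  rcases Nat.eq_zero_or_pos n with rfl | hn
  · simp at h
  · rw [Polynomial.mem_nthRootsFinset hn]
    exact ((mem_primitiveRoots hn).1 h).pow_eq_one

theorem inv_norm_sub_le {q Λ : ℂ} (hq : ‖q‖ ≠ 1) (hΛ : ‖Λ‖ = 1) :
    ‖(q - Λ)⁻¹‖ ≤ |‖q‖ - 1|⁻¹ := by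
  rw [norm_inv]
  refine inv_anti₀ (abs_pos.2 (sub_ne_zero.2 hq)) ?_
  rw [← hΛ]
  exact abs_norm_sub_norm_le q Λ

theorem norm_sum_poles_le {q : ℂ} (hq : ‖q‖ ≠ 1) {T : Finset ℂ} {n : ℕ}
    (hT : T ⊆ Polynomial.nthRootsFinset n (1 : ℂ)) :
    ‖∑ Λ ∈ T, (q - Λ)⁻¹‖ ≤ n * |‖q‖ - 1|⁻¹ := by
  rcases Nat.eq_zero_or_pos n with rfl | hn
  · have : T = ∅ := by simpa using hT
    simp [this]
  calc _ ≤ ∑ Λ ∈ T, |‖q‖ - 1|⁻¹ := norm_sum_le_of_le _ fun Λ hΛ =>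
        inv_norm_sub_le hq (norm_eq_one_of_mem_nthRootsFinset hn (hT hΛ))
    _ = T.card * |‖q‖ - 1|⁻¹ := by rw [Finset.sum_const, nsmul_eq_mul]
    _ ≤ _ := by
      gcongr
      exact (Finset.card_le_card hT).trans (card_nthRootsFinset_le n)

theorem pow_ne_one_of_norm_ne_one {q : ℂ} (hq : ‖q‖ ≠ 1) {m : ℕ} (hm : 0 < m) : q ^ m ≠ 1 :=
  fun h => hq (Complex.norm_eq_one_of_pow_eq_one h hm.ne')

/-- Logarithmic derivative of `X^(n+1) - 1`, whose roots are simple. -/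
theorem sum_poles_nthRootsFinset {q : ℂ} (n : ℕ) (hq : q ^ (n + 1) ≠ 1) :
    ∑ Λ ∈ Polynomial.nthRootsFinset (n + 1) (1 : ℂ), (q - Λ)⁻¹ =
      (n + 1) * q ^ n / (q ^ (n + 1) - 1) := by
  have h := (IsAlgClosed.splits
    (Polynomial.X ^ (n + 1) - Polynomial.C (1 : ℂ))).eval_derivative_div_eval_of_ne_zero
    (x := q) (by simpa [sub_eq_zero] using hq)
  have hnd := (Complex.isPrimitiveRoot_exp (n + 1) n.succ_ne_zero).nthRoots_one_nodup
  rw [Polynomial.nthRoots] at hnd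
  have h2 : (Polynomial.nthRootsFinset (n + 1) (1 : ℂ)).val =
      (Polynomial.X ^ (n + 1) - Polynomial.C (1 : ℂ)).roots := by
    rw [Polynomial.nthRootsFinset_def, Multiset.toFinset_val, Polynomial.nthRoots,
      Multiset.dedup_eq_self.2 hnd]
  rw [Finset.sum, h2]
  simp only [one_div] at h
  rw [← h]
  simp

theorem sum_poles_eq_sum_divisors (n : ℕ) (q : ℂ) :
    ∑ Λ ∈ Polynomial.nthRootsFinset n (1 : ℂ), (q - Λ)⁻¹ =
      ∑ d ∈ n.divisors, ∑ Λ ∈ primitiveRoots d ℂ, (q - Λ)⁻¹ := by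
  classical
  rw [IsPrimitiveRoot.nthRoots_one_eq_biUnion_primitiveRoots, Finset.sum_biUnion]
  intro a _ b _ hab
  exact IsPrimitiveRoot.disjoint hab

/-- Roots are sorted by exact order `a`, writing `n = ab`; the total weight of order `a` is then
given by `tsum_pnat_residue`. -/
theorem tsum_residue_poles_eq_gammelSeries {q : ℂ} (hq : ‖q‖ ≠ 1) :
    ∑' n : ℕ, residue (n + 1) * ∑ Λ ∈ Polynomial.nthRootsFinset (n + 1) (1 : ℂ), (q - Λ)⁻¹ =
      gammelSeries q := by
  set S : ℕ → ℂ := fun d => ∑ Λ ∈ primitiveRoots d ℂ, (q - Λ)⁻¹ with hS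
  have hSb : ∀ d, ‖S d‖ ≤ d * |‖q‖ - 1|⁻¹ := fun d =>
    norm_sum_poles_le hq (primitiveRoots_subset_nthRootsFinset d)
  have hG : gammelSeries q = ∑' a : ℕ+, S a * gammelCoeff a := by
    have e : ∀ m : ℕ, ∑ Λ ∈ primitiveRoots m ℂ, gammelCoeff m / (q - Λ) = S m * gammelCoeff m := by
      intro m
      simp only [hS, Finset.sum_mul, div_eq_inv_mul]
    have hsum : Summable fun m : ℕ => S m * gammelCoeff m := by
      have hs := Real.summable_pow_mul_exp_neg_nat_mul 1 one_pos
      refine (hs.mul_left |‖q‖ - 1|⁻¹).of_norm_bounded fun m => ?_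
      rw [norm_mul]
      calc _ ≤ (m * |‖q‖ - 1|⁻¹) * Real.exp (-(m : ℝ)) :=
            mul_le_mul (hSb m) (norm_gammelCoeff_le m) (norm_nonneg _) (by positivity)
        _ = _ := by rw [pow_one, neg_one_mul]; ring
    rw [gammelSeries]
    simp only [e]
    rw [hsum.tsum_eq_zero_add, tsum_pnat_eq_tsum_succ (f := fun m => S m * gammelCoeff m)]
    simp [hS]
  rw [hG, ← tsum_pnat_eq_tsum_succ (f := fun n =>
    residue n * ∑ Λ ∈ Polynomial.nthRootsFinset n (1 : ℂ), (q - Λ)⁻¹)]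
  have h1 : ∀ a : ℕ+, S a * gammelCoeff a = ∑' b : ℕ+, S a * residue (a * b) := fun a => by
    rw [tsum_mul_left, tsum_pnat_residue a.pos]
  simp only [h1]
  rw [tsum_tsum_eq_tsum_divisorsAntidiagonal (F := fun a b => S a * residue (a * b))]
  · refine tsum_congr fun n => ?_
    rw [sum_poles_eq_sum_divisors, Finset.mul_sum]
    have : ∀ x ∈ (n : ℕ).divisorsAntidiagonal,
        S x.1 * residue (x.1 * x.2) = residue n * S x.1 := fun x hx => by
      rw [(Nat.mem_divisorsAntidiagonal.1 hx).1, mul_comm]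
    rw [Finset.sum_congr rfl this,
      Nat.sum_divisorsAntidiagonal (f := fun a _ => residue n * S a)]
  -- The swap puts the linear weight, which bounds the number of primitive roots of order `a`, on
  -- the first index.
  · have hs := (Equiv.prodComm ℕ+ ℕ+).summable_iff.2 (summable_prod_mul_pow 1 exp_neg_one_lt_one)
    refine (hs.mul_left (2 * |‖q‖ - 1|⁻¹)).of_norm_bounded fun p => ?_
    rw [norm_mul]
    have hr := norm_residue_le (Nat.mul_pos p.1.pos p.2.pos)
    calc _ ≤ ((p.1 : ℕ) * |‖q‖ - 1|⁻¹) * (2 * Real.exp (-((p.1 * p.2 : ℕ) : ℝ))) :=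
          mul_le_mul (hSb _) hr (norm_nonneg _) (by positivity)
      _ = _ := by
        simp only [Function.comp, Equiv.prodComm_apply, Prod.snd_swap, Prod.fst_swap, pow_one,
          exp_neg_one_pow]
        rw [mul_comm (p.2 : ℕ)]
        ring

/-! ### The regularised solution -/

theorem summable_coeff_mul_pow {r : ℝ} (g : B r) {z : ℂ} (hz : z ∈ ball (0 : ℂ) r) :
    Summable fun n : ℕ => ‖coeff g (n + 1) * z ^ (n + 1)‖ := by
  have h := (Complex.hasSum_taylorSeries_on_ball g.2.1 hz).summable
  have h2 := (summable_nat_add_iff 1).2 h.norm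
  refine h2.congr fun n => ?_
  congr 1
  rw [coeff, sub_zero, smul_eq_mul, smul_eq_mul]
  ring

theorem abs_norm_sub_one_le_norm_pow_sub_one (q : ℂ) (n : ℕ) :
    |‖q‖ - 1| ≤ ‖q ^ (n + 1) - 1‖ := by
  have h1 : |‖q‖ ^ (n + 1) - 1| ≤ ‖q ^ (n + 1) - 1‖ := by
    have := abs_norm_sub_norm_le (q ^ (n + 1)) 1
    rwa [norm_pow, norm_one] at this
  refine le_trans ?_ h1
  rcases le_total ‖q‖ 1 with h | h
  · have : ‖q‖ ^ (n + 1) ≤ ‖q‖ := pow_le_of_le_one (norm_nonneg _) h n.succ_ne_zero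
    rw [abs_of_nonpos (by linarith), abs_of_nonpos (by linarith)]
    linarith
  · have : ‖q‖ ≤ ‖q‖ ^ (n + 1) := le_self_pow₀ h n.succ_ne_zero
    rw [abs_of_nonneg (by linarith), abs_of_nonneg (by linarith)]
    linarith

/-- Termwise, `p⁻¹ (1/(p^(n+1) - 1) + 1) = p^n/(p^(n+1) - 1)`. At `q = 0` the derivative is the
limit of these slopes, found by continuity of the series near `0`. -/
theorem chi_eq_tsum {r : ℝ} (g : B r) {z q : ℂ} (hz : z ∈ ball (0 : ℂ) r) (hq : ‖q‖ ≠ 1) :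
    chi g q z = ∑' n : ℕ, coeff g (n + 1) * z ^ (n + 1) * (q ^ n / (q ^ (n + 1) - 1)) := by
  have hc := summable_coeff_mul_pow g hz
  have hsol : ∀ p : ℂ, ‖p‖ ≠ 1 → Summable fun n : ℕ =>
      coeff g (n + 1) * z ^ (n + 1) / (p ^ (n + 1) - 1) := by
    intro p hp
    refine (hc.mul_right |‖p‖ - 1|⁻¹).of_norm_bounded fun n => ?_
    rw [norm_div, div_eq_mul_inv]
    have : 0 < |‖p‖ - 1| := abs_pos.2 (sub_ne_zero.2 hp)
    gcongr
    exact abs_norm_sub_one_le_norm_pow_sub_one p n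
  have hslope : ∀ p : ℂ, ‖p‖ ≠ 1 → p ≠ 0 → slope (fun p => solution g p z) 0 p =
      ∑' n : ℕ, coeff g (n + 1) * z ^ (n + 1) * (p ^ n / (p ^ (n + 1) - 1)) := by
    intro p hp hp0
    rw [slope_def_module, sub_zero, smul_eq_mul, solution, solution,
      ← (hsol p hp).tsum_sub (hsol 0 (by simp)), ← tsum_mul_left]
    refine tsum_congr fun n => ?_
    have : p ^ (n + 1) - 1 ≠ 0 := sub_ne_zero.2 (pow_ne_one_of_norm_ne_one hp n.succ_pos)
    rw [zero_pow n.succ_ne_zero]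
    field_simp
    ring
  rcases eq_or_ne q 0 with rfl | hq0
  · rw [chi, dslope_same]
    apply HasDerivAt.deriv
    rw [hasDerivAt_iff_tendsto_slope]
    have hcont : ContinuousOn (fun p : ℂ => ∑' n : ℕ,
        coeff g (n + 1) * z ^ (n + 1) * (p ^ n / (p ^ (n + 1) - 1))) (ball 0 (1 / 2)) := by
      have hlt : ∀ p ∈ ball (0 : ℂ) (1 / 2), ‖p‖ < 1 / 2 := fun p hp => mem_ball_zero_iff.1 hp
      refine continuousOn_tsum (fun n => ?_) (hc.mul_right 2) fun n p hp => ?_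
      · refine continuousOn_const.mul (ContinuousOn.div (by fun_prop) (by fun_prop) fun p hp => ?_)
        exact sub_ne_zero.2 (pow_ne_one_of_norm_ne_one (by linarith [hlt p hp]) n.succ_pos)
      · rw [norm_mul, norm_div, norm_pow]
        have h1 := abs_norm_sub_one_le_norm_pow_sub_one p n
        have h2 := hlt p hp
        rw [abs_of_nonpos (by linarith)] at h1
        have h3 : ‖p‖ ^ n ≤ 1 := pow_le_one₀ (norm_nonneg _) (by linarith)
        gcongr
        rw [div_le_iff₀ (by linarith)]
        linarith
    have hlim := (hcont.continuousAt (ball_mem_nhds _ (by norm_num))).tendsto.mono_left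
      (nhdsWithin_le_nhds (s := {0}ᶜ))
    refine hlim.congr' ?_
    filter_upwards [self_mem_nhdsWithin, mem_nhdsWithin_of_mem_nhds
      (ball_mem_nhds (0 : ℂ) one_pos)] with p hp hp1
    exact (hslope p (mem_ball_zero_iff.1 hp1).ne hp).symm
  · rw [chi, dslope_of_ne _ hq0, hslope q hq hq0]

theorem summable_poles_smul {E : Type*} [NormedAddCommGroup E] [NormedSpace ℂ E] [CompleteSpace E]
    {T : ℕ → Finset ℂ} {v : ℕ → E} {C : ℝ} {k : ℕ}
    (hT : ∀ n, T n ⊆ Polynomial.nthRootsFinset (n + k) (1 : ℂ))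
    (hv : ∀ n, ‖v n‖ ≤ C * Real.exp (-(n : ℝ) / 2)) {q : ℂ} (hq : ‖q‖ ≠ 1) :
    Summable fun n => (∑ Λ ∈ T n, (q - Λ)⁻¹) • v n := by
  have hC : 0 ≤ C := nonneg_of_mul_nonneg_left ((norm_nonneg _).trans (hv 0)) (Real.exp_pos _)
  -- The constant is the one in `moment_le` with `σ = N = 0` and `d = 1`: only the linear growth in
  -- the number of poles has to be absorbed.
  refine ((summable_exp_neg_div (c := 4) (by norm_num)).mul_left
    (((k + 1) * |‖q‖ - 1|⁻¹ * C) * ((Real.exp (1 / 4) * 8 ^ 1 * (Nat.factorial 1)) *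
      (8 ^ 0) ^ 0 * (0 * 0).factorial))).of_norm_bounded fun n => ?_
  rw [norm_smul]
  calc _ ≤ ((n + k : ℕ) * |‖q‖ - 1|⁻¹) * (C * Real.exp (-(n : ℝ) / 2)) :=
        mul_le_mul (norm_sum_poles_le hq (hT n)) (hv n) (norm_nonneg _) (by positivity)
    _ ≤ ((k + 1) * ((n : ℝ) + 1) * |‖q‖ - 1|⁻¹) * (C * Real.exp (-(n : ℝ) / 2)) := by
      gcongr
      push_cast
      nlinarith [n.cast_nonneg (α := ℝ), k.cast_nonneg (α := ℝ),
        mul_nonneg (n.cast_nonneg (α := ℝ)) (k.cast_nonneg (α := ℝ))]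
    _ = ((k + 1) * |‖q‖ - 1|⁻¹ * C) *
        (((n : ℝ) + 1) ^ (0 * 0 + 1) * Real.exp (-(n : ℝ) / 2)) := by ring
    _ ≤ ((k + 1) * |‖q‖ - 1|⁻¹ * C) * _ :=
      mul_le_mul_of_nonneg_left (moment_le 0 1 0 n) (by positivity)
    _ = _ := by ring

theorem HasGevreyExpansionOn.congr {E : Type*} [NormedAddCommGroup E] [NormedSpace ℂ E] {τ : ℝ}
    {l : ℂ} {s : Set ℂ} {f g : ℂ → E} {a : ℕ → E} (h : HasGevreyExpansionOn τ l s f a)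
    (hfg : ∀ q ∈ s, g q = f q) : HasGevreyExpansionOn τ l s g a := by
  obtain ⟨hd, c₀, h0, c₁, h1, hb⟩ := h
  exact ⟨hd.congr hfg, c₀, h0, c₁, h1, fun N q hq => by rw [hfg q hq]; exact hb N q hq⟩

/-- A holomorphic function has Gevrey expansions of all orders. -/
theorem hasGevreyExpansionOn_of_differentiableOn {E : Type*} [NormedAddCommGroup E]
    [NormedSpace ℂ E] [CompleteSpace E] (σ : ℕ) {l : ℂ} {R : ℝ} (hR : 0 < R) {f : ℂ → E}
    (hf : DifferentiableOn ℂ f (ball l R)) :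
    ∃ a, HasGevreyExpansionOn σ l (ball l (R / 4)) f a := by
  set R₁ : NNReal := ⟨R / 2, by positivity⟩
  set R₂ : NNReal := ⟨R / 4, by positivity⟩
  have hR₁ : (R₁ : ℝ) = R / 2 := rfl
  have hR₂ : (R₂ : ℝ) = R / 4 := rfl
  have hp := DifferentiableOn.hasFPowerSeriesOnBall (R := R₁) (c := l) (f := f)
    (hf.mono (closedBall_subset_ball (by rw [hR₁]; linarith)))
    (NNReal.coe_pos.1 (by rw [hR₁]; positivity))
  obtain ⟨a, ha, C, hC, hb⟩ := hp.uniform_geometric_approx' (r' := R₂)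
    (by rw [ENNReal.coe_lt_coe, ← NNReal.coe_lt_coe, hR₁, hR₂]; linarith)
  refine ⟨(cauchyPowerSeries f l R₁).coeff, hf.mono (ball_subset_ball (by linarith)), C, hC, 4 / R,
    by positivity, fun N q hq => ?_⟩
  have h := hb (q - l) (by rwa [mem_ball_zero_iff, ← dist_eq_norm]) N
  rw [add_sub_cancel, FormalMultilinearSeries.partialSum] at h
  simp only [FormalMultilinearSeries.apply_eq_pow_smul_coeff] at h
  rw [gamma_one_add_mul_natCast]
  refine h.trans ?_
  have hfac : (1 : ℝ) ≤ (σ * N).factorial := by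
    exact_mod_cast Nat.one_le_iff_ne_zero.2 (Nat.factorial_ne_zero _)
  have ha1 : a ^ N ≤ 1 := pow_le_one₀ ha.1.le ha.2.le
  rw [hR₂, mul_pow]
  calc C * (a ^ N * (‖q - l‖ / (R / 4)) ^ N) ≤ C * (1 * (‖q - l‖ / (R / 4)) ^ N) := by gcongr
    _ = C * (4 / R) ^ N * 1 * ‖q - l‖ ^ N := by
      rw [one_mul, mul_one, mul_assoc, ← mul_pow]; congr 2; field_simp
    _ ≤ _ := by gcongr

/-! ### Gammel's series at roots of unity -/

/-- `Λ₀` is primitive for exactly one order, so it contributes a single simple pole. The other poles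
satisfy `|Λ₀ - Λ| ≥ 4/(Mn)`, hence the exponent `σ = 1`. -/
theorem gammelSeries_mem_poleGevreyClass {Λ₀ : ℂ} (h : Λ₀ ∈ rootsOfUnitySet) :
    gammelSeries ∈ poleGevreyClass 1 Λ₀ ℂ := by
  classical
  obtain ⟨M, hM, hM1⟩ := h
  have hΛ₀ : ‖Λ₀‖ = 1 := Complex.norm_eq_one_of_pow_eq_one hM1 (by omega)
  set T : ℕ → Finset ℂ := fun n => (primitiveRoots n ℂ).erase Λ₀ with hT
  have hsub : ∀ n, T n ⊆ Polynomial.nthRootsFinset (n + 0) (1 : ℂ) := fun n =>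
    (Finset.erase_subset _ _).trans (primitiveRoots_subset_nthRootsFinset n)
  have hmem : ∀ n, ∀ Λ ∈ T n, 0 < n ∧ Λ ^ n = 1 ∧ Λ ≠ Λ₀ := by
    intro n Λ hΛ
    have hn : 0 < n := by
      rcases Nat.eq_zero_or_pos n with rfl | hn
      · simp [hT] at hΛ
      · exact hn
    exact ⟨hn, (Polynomial.mem_nthRootsFinset hn 1).1 (hsub n hΛ), (Finset.mem_erase.1 hΛ).1⟩
  have hv : ∀ n, ‖gammelCoeff n‖ ≤ 1 * Real.exp (-(n : ℝ) / 2) := fun n => by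
    rw [one_mul]
    refine (norm_gammelCoeff_le n).trans (Real.exp_le_exp.2 ?_)
    linarith [n.cast_nonneg (α := ℝ)]
  have hρ : (1 / 2 : ℝ) ∈ Set.Ioo (0 : ℝ) 1 := by constructor <;> norm_num
  have hM0 : (0 : ℝ) < M := by exact_mod_cast hM
  obtain ⟨a, ha⟩ := hasGevreyExpansionOn_poles (σ := 1) (l := Λ₀) (isOpen_tangentDisks Λ₀ (1 / 2))
    (T := T) (v := gammelCoeff) (C := 1) (κ := 4 / M) (c := (1 - 1 / 2) / 4) one_pos
    (by positivity) (by norm_num)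
    (fun n => ((Finset.card_le_card (hsub n)).trans (card_nthRootsFinset_le _)).trans n.le_succ)
    hv
    (fun n Λ hΛ => by
      obtain ⟨hn, h1, h2⟩ := hmem n Λ hΛ
      have hn' : (0 : ℝ) < n := by exact_mod_cast hn
      refine le_trans ?_ (norm_sub_ge_of_pow_eq_one hM hn hM1 h1 h2)
      rw [pow_one, div_div]
      gcongr
      linarith)
    (fun n Λ hΛ q hq => norm_sub_ge_of_mem_tangentDisks hΛ₀
      (Complex.norm_eq_one_of_pow_eq_one (hmem n Λ hΛ).2.1 (hmem n Λ hΛ).1.ne') hρ hq)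
  -- The residue at `Λ₀`, written in the form produced by `hasSum_single`; it is `0` when `Λ₀ = 1`.
  set c : ℂ := if Λ₀ ∈ primitiveRoots (orderOf Λ₀) ℂ then gammelCoeff (orderOf Λ₀) else 0 with hc
  have hsplit : ∀ q ∈ tangentDisks Λ₀ (1 / 2), gammelSeries q =
      (∑' n, (∑ Λ ∈ T n, (q - Λ)⁻¹) • gammelCoeff n) + (q - Λ₀)⁻¹ * c := by
    intro q hq
    have h1 := summable_poles_smul hsub hv
      (norm_ne_one_of_mem_tangentDisks (by norm_num) hΛ₀ hq)
    have h2 := hasSum_single (f := fun n => (q - Λ₀)⁻¹ *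
        if Λ₀ ∈ primitiveRoots n ℂ then gammelCoeff n else 0) (orderOf Λ₀) fun n hn => by
      rw [if_neg, mul_zero]
      intro hmem
      rcases Nat.eq_zero_or_pos n with rfl | hn0
      · simp at hmem
      · exact hn ((mem_primitiveRoots hn0).1 hmem).eq_orderOf
    rw [gammelSeries, ← (h1.hasSum.add h2).tsum_eq]
    refine tsum_congr fun n => ?_
    simp only [div_eq_inv_mul]
    rw [← Finset.sum_mul, smul_eq_mul]
    by_cases hΛ : Λ₀ ∈ primitiveRoots n ℂ
    · rw [if_pos hΛ, ← add_mul, hT, Finset.sum_erase_add _ _ hΛ]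
    · rw [if_neg hΛ, mul_zero, add_zero]
      simp only [hT, Finset.erase_eq_of_notMem hΛ]
  have hbd : ∀ q ∈ tangentDisks Λ₀ (1 / 2), ‖q - Λ₀‖ ≤ 1 := by
    rintro q (hq | hq)
    all_goals
      rw [mem_ball, dist_eq_norm] at hq
    · have h1 := norm_sub_le_norm_sub_add_norm_sub q ((1 - ((1 / 2 : ℝ) : ℂ)) * Λ₀) Λ₀
      have h2 : ‖(1 - ((1 / 2 : ℝ) : ℂ)) * Λ₀ - Λ₀‖ = 1 / 2 := by
        rw [show (1 - ((1 / 2 : ℝ) : ℂ)) * Λ₀ - Λ₀ = -(((1 / 2 : ℝ) : ℂ) * Λ₀) by ring, norm_neg,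
          norm_mul, hΛ₀, Complex.norm_real]
        norm_num
      linarith
    · have h1 := norm_sub_le_norm_sub_add_norm_sub q ((1 + ((1 / 2 : ℝ) : ℂ)) * Λ₀) Λ₀
      have h2 : ‖(1 + ((1 / 2 : ℝ) : ℂ)) * Λ₀ - Λ₀‖ = 1 / 2 := by
        rw [show (1 + ((1 / 2 : ℝ) : ℂ)) * Λ₀ - Λ₀ = ((1 / 2 : ℝ) : ℂ) * Λ₀ by ring,
          norm_mul, hΛ₀, Complex.norm_real]
        norm_num
      linarith
  obtain ⟨b, hb⟩ := ha.const_add_mul zero_le_one hbd c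
  refine ⟨1 / 2, hρ, b, ?_⟩
  rw [Nat.cast_one] at hb
  refine hb.congr fun q hq => ?_
  have hne : q - Λ₀ ≠ 0 := sub_ne_zero.2 fun h => notMem_tangentDisks (by norm_num) hΛ₀ (h ▸ hq)
  rw [hsplit q hq, smul_eq_mul, mul_add, mul_inv_cancel_left₀ hne, add_comm]

/-! ### The regularised solution at constant-type points -/

/-- The coefficients decay like `e^(-n)` and `r^n` takes back at most `e^(n/4)`. The margin beyond
`e^(-n/2)` pays for `norm_holomorphic_part_le`. -/
theorem norm_residue_smul_monomial_le {r : ℝ} (hr : 0 ≤ r) (hr' : r ≤ Real.exp (1 / 4)) (n : ℕ) :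
    ‖residue (n + 1) • monomial r n‖ ≤ 2 * Real.exp (-(3 * (n : ℝ)) / 4) := by
  rw [norm_smul]
  calc _ ≤ (2 * Real.exp (-((n + 1 : ℕ) : ℝ))) * Real.exp (1 / 4) ^ (n + 1) := by
        refine mul_le_mul (norm_residue_le n.succ_pos) ((norm_monomial_le hr n).trans ?_)
          (norm_nonneg _) (by positivity)
        gcongr
    _ = 2 * Real.exp (-(3 * ((n : ℝ) + 1)) / 4) := by
        rw [← Real.exp_nat_mul, mul_assoc, ← Real.exp_add]
        congr 2; push_cast; ring
    _ ≤ _ := by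
        gcongr
        linarith

theorem norm_residue_smul_monomial_le' {r : ℝ} (hr : 0 ≤ r) (hr' : r ≤ Real.exp (1 / 4)) (n : ℕ) :
    ‖residue (n + 1) • monomial r n‖ ≤ 2 * Real.exp (-(n : ℝ) / 2) := by
  refine (norm_residue_smul_monomial_le hr hr' n).trans ?_
  gcongr 2 * Real.exp ?_
  linarith [n.cast_nonneg (α := ℝ)]

/-- The regularised solution as a function with values in `B r`, in the form of a series of simple
poles. -/
def poleSeries (r : ℝ) (q : ℂ) : B r :=
  ∑' n : ℕ, (∑ Λ ∈ Polynomial.nthRootsFinset (n + 1) (1 : ℂ), (q - Λ)⁻¹) •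
    (residue (n + 1) • monomial r n)

theorem summable_poleSeries {r : ℝ} (hr : 0 ≤ r) (hr' : r ≤ Real.exp (1 / 4)) {q : ℂ}
    (hq : ‖q‖ ≠ 1) :
    Summable fun n : ℕ => (∑ Λ ∈ Polynomial.nthRootsFinset (n + 1) (1 : ℂ), (q - Λ)⁻¹) •
      (residue (n + 1) • monomial r n) :=
  summable_poles_smul (fun _ => subset_rfl) (norm_residue_smul_monomial_le' hr hr') hq

theorem poleSeries_apply {r : ℝ} (hr : 0 ≤ r) (hr' : r ≤ Real.exp (1 / 4)) {q : ℂ}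
    (hq : ‖q‖ ≠ 1) (z : ball (0 : ℂ) r) :
    (poleSeries r q : ball (0 : ℂ) r →ᵇ ℂ) z = ∑' n : ℕ,
      residue (n + 1) * (∑ Λ ∈ Polynomial.nthRootsFinset (n + 1) (1 : ℂ), (q - Λ)⁻¹) *
        (z : ℂ) ^ (n + 1) := by
  rw [← evalCLM_apply, poleSeries, (evalCLM z).map_tsum (summable_poleSeries hr hr' hq)]
  refine tsum_congr fun n => ?_
  rw [map_smul, map_smul, evalCLM_apply, monomial_apply, smul_eq_mul, smul_eq_mul]
  ring

theorem coeff_poleSeries {r : ℝ} (hr : 0 < r) (hr' : r ≤ Real.exp (1 / 4)) {q : ℂ}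
    (hq : ‖q‖ ≠ 1) (n : ℕ) :
    coeff (poleSeries r q) (n + 1) =
      (∑ Λ ∈ Polynomial.nthRootsFinset (n + 1) (1 : ℂ), (q - Λ)⁻¹) * residue (n + 1) := by
  have hs := summable_poleSeries hr.le hr' hq
  simp only [smul_smul] at hs
  rw [poleSeries]
  simp only [smul_smul]
  exact coeff_tsum_smul_monomial hr hs n

theorem poleSeries_mem_gevreyClass {r : ℝ} (hr : 0 ≤ r) (hr' : r ≤ Real.exp (1 / 4)) {l : ℂ}
    (hl : l ∈ diophantinePoints 2) : poleSeries r ∈ gevreyClass (2 * 1) l (B r) := by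
  have hl1 := norm_eq_one_of_mem_diophantinePoints hl
  obtain ⟨κ, hκ, hdist⟩ := exists_norm_sub_ge_of_diophantine hl
  have hρ : (1 / 2 : ℝ) ∈ Set.Ioo (0 : ℝ) 1 := by constructor <;> norm_num
  obtain ⟨a, ha⟩ := hasGevreyExpansionOn_poles (σ := 2) (l := l) (isOpen_tangentDisks l (1 / 2))
    (T := fun n => Polynomial.nthRootsFinset (n + 1) (1 : ℂ)) (C := 2) (c := (1 - 1 / 2) / 4)
    two_pos hκ (by norm_num) (fun n => card_nthRootsFinset_le _)
    (norm_residue_smul_monomial_le' hr hr')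
    (fun n Λ hΛ => hdist n Λ ((Polynomial.mem_nthRootsFinset n.succ_pos 1).1 hΛ))
    (fun n Λ hΛ q hq => norm_sub_ge_of_mem_tangentDisks hl1
      (norm_eq_one_of_mem_nthRootsFinset n.succ_pos hΛ) hρ hq)
  refine ⟨1 / 2, hρ, a, ?_⟩
  rw [mul_one, ← Nat.cast_ofNat]
  exact ha

/-- The roots of unity of order dividing `n` that belong to `S`. -/
def rootsIn (S : Set ℂ) (n : ℕ) : Finset ℂ :=
  open Classical in (Polynomial.nthRootsFinset n (1 : ℂ)).filter (· ∈ S)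

theorem rootsIn_subset (S : Set ℂ) (n : ℕ) : rootsIn S n ⊆ Polynomial.nthRootsFinset n (1 : ℂ) :=
  open Classical in Finset.filter_subset _ _

theorem mem_of_mem_rootsIn {S : Set ℂ} {n : ℕ} {Λ : ℂ} (h : Λ ∈ rootsIn S n) : Λ ∈ S := by
  classical
  unfold rootsIn at h
  exact (Finset.mem_filter.1 h).2

/-- Geometric summation of `(q/Λ)^ℓ`, using `Λ^(n+1) = 1`. The factor `q^(n+1) - 1` will cancel the
denominator in the coefficient of the regularised solution. -/
theorem deltaCoeff_eq {S : Set ℂ} {n : ℕ} {q : ℂ} (hq : ‖q‖ ≠ 1) :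
    deltaCoeff S (n + 1) q =
      (1 / ((n : ℂ) + 1)) * ∑ Λ ∈ rootsIn S (n + 1), Λ * (q ^ (n + 1) - 1) * (q - Λ)⁻¹ := by
  have h : ∀ Λ ∈ rootsIn S (n + 1), Λ * (q ^ (n + 1) - 1) * (q - Λ)⁻¹ =
      ∑ ℓ ∈ Finset.range (n + 1), (Λ ^ ℓ)⁻¹ * q ^ ℓ := by
    intro Λ hΛ
    have hΛ1 := (Polynomial.mem_nthRootsFinset n.succ_pos 1).1 (rootsIn_subset S _ hΛ)
    have hn := norm_eq_one_of_mem_nthRootsFinset n.succ_pos (rootsIn_subset S _ hΛ)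
    have hne : q - Λ ≠ 0 := sub_ne_zero.2 fun h => hq (h ▸ hn)
    have hΛ0 : Λ ≠ 0 := norm_pos_iff.1 (by rw [hn]; exact one_pos)
    have hg := geom_sum₂_mul q Λ (n + 1)
    rw [hΛ1] at hg
    rw [← hg, ← mul_assoc, mul_inv_cancel_right₀ hne, Finset.mul_sum]
    refine Finset.sum_congr rfl fun ℓ hℓ => ?_
    have hℓ' : ℓ ≤ n := Nat.lt_succ_iff.1 (Finset.mem_range.1 hℓ)
    have e : Λ * Λ ^ (n + 1 - 1 - ℓ) = (Λ ^ ℓ)⁻¹ := by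
      refine eq_inv_of_mul_eq_one_left ?_
      rw [← pow_succ', ← pow_add,
        show n + 1 - 1 - ℓ + 1 + ℓ = n + 1 by omega, hΛ1]
    rw [← e]; ring
  rw [Finset.sum_congr rfl h, Finset.sum_comm, Finset.mul_sum, deltaCoeff]
  refine Finset.sum_congr rfl fun ℓ _ => ?_
  rw [← Finset.sum_mul, ← mul_assoc, Nat.cast_succ]
  rfl

/-- Splits `Λ q^n = 1 + Λ (q^n - Λ^n)`: a pole of residue `1` and a polynomial in `q`. -/
theorem mul_pow_mul_inv_sub_eq {q Λ : ℂ} {n : ℕ} (hΛ : Λ ^ (n + 1) = 1) (hne : q ≠ Λ) :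
    Λ * q ^ n * (q - Λ)⁻¹ =
      (q - Λ)⁻¹ + Λ * ∑ i ∈ Finset.range n, q ^ i * Λ ^ (n - 1 - i) := by
  have hne' : q - Λ ≠ 0 := sub_ne_zero.2 hne
  have hg := geom_sum₂_mul q Λ n
  rw [mul_inv_eq_iff_eq_mul₀ hne', add_mul, inv_mul_cancel₀ hne', mul_assoc, hg, mul_sub,
    ← pow_succ' Λ, hΛ]
  ring

theorem norm_holomorphic_part_le {S : Set ℂ} {n : ℕ} {q : ℂ} (hq : ‖q‖ ≤ 5 / 4) :
    ‖∑ Λ ∈ rootsIn S (n + 1), Λ * ∑ i ∈ Finset.range n, q ^ i * Λ ^ (n - 1 - i)‖ ≤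
      ((n : ℝ) + 1) ^ 2 * Real.exp ((n : ℝ) / 4) := by
  have hexp : (5 / 4 : ℝ) ≤ Real.exp (1 / 4) := by
    have := Real.add_one_le_exp (1 / 4 : ℝ); linarith
  have h1 : ∀ Λ ∈ rootsIn S (n + 1),
      ‖Λ * ∑ i ∈ Finset.range n, q ^ i * Λ ^ (n - 1 - i)‖ ≤
        ((n : ℝ) + 1) * Real.exp ((n : ℝ) / 4) := by
    intro Λ hΛ
    have hn := norm_eq_one_of_mem_nthRootsFinset n.succ_pos (rootsIn_subset S _ hΛ)
    rw [norm_mul, hn, one_mul]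
    calc _ ≤ ∑ i ∈ Finset.range n, Real.exp ((n : ℝ) / 4) := by
          refine norm_sum_le_of_le _ fun i hi => ?_
          rw [norm_mul, norm_pow, norm_pow, hn, one_pow, mul_one]
          calc _ ≤ (5 / 4 : ℝ) ^ i := by gcongr
            _ ≤ (5 / 4 : ℝ) ^ n :=
              pow_le_pow_right₀ (by norm_num) (Finset.mem_range.1 hi).le
            _ ≤ Real.exp (1 / 4) ^ n := by gcongr
            _ = _ := by rw [← Real.exp_nat_mul]; congr 1; ring
      _ = n * Real.exp ((n : ℝ) / 4) := by
          rw [Finset.sum_const, Finset.card_range, nsmul_eq_mul]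
      _ ≤ _ := by gcongr; linarith
  have hcard : ((rootsIn S (n + 1)).card : ℝ) ≤ (n : ℝ) + 1 := by
    exact_mod_cast (Finset.card_le_card (rootsIn_subset S _)).trans (card_nthRootsFinset_le _)
  calc _ ≤ ∑ Λ ∈ rootsIn S (n + 1), ((n : ℝ) + 1) * Real.exp ((n : ℝ) / 4) :=
        norm_sum_le_of_le _ h1
    _ = (rootsIn S (n + 1)).card * (((n : ℝ) + 1) * Real.exp ((n : ℝ) / 4)) := by
        rw [Finset.sum_const, nsmul_eq_mul]
    _ ≤ ((n : ℝ) + 1) * (((n : ℝ) + 1) * Real.exp ((n : ℝ) / 4)) := by gcongr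
    _ = _ := by ring

/-- After cancellation of `q^(n+1) - 1` the product has coefficients `R_{n+1} ∑_{Λ ∈ S} Λ q^n/(q -
Λ)`. The polar part has poles only in `S`, quadratically separated from the cardioid; the polynomial
parts sum to a holomorphic function near `l`, since `|q| ≤ 5/4 ≤ e^(1/4)` there. -/
theorem exists_hadamard_extension {l : ℂ} (hl : l ∈ diophantinePoints 2) {J : ℂ}
    (hJ : J = Complex.I ∨ J = -Complex.I) {S : Set ℂ}
    (hS : ∀ Λ ∈ S, ((Λ / l - 1) / J).re ≤ 0) {r : ℝ} (hr : 0 < r) (hr' : r ≤ Real.exp (1 / 4)) :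
    ∃ h : ℂ → B r, (∃ ρ : ℝ, 0 < ρ ∧ ∃ a, HasGevreyExpansionOn (2 * 1) l (cardioid J l ρ) h a) ∧
      ∃ ρ ∈ Set.Ioo (0 : ℝ) 1, ∀ q ∈ tangentDisks l ρ ∩ cardioid J l ρ, ∀ n : ℕ,
        coeff (h q) n = coeff (poleSeries r q) n * deltaCoeff S n q := by
  have hl1 := norm_eq_one_of_mem_diophantinePoints hl
  have hl0 : l ≠ 0 := norm_pos_iff.1 (by rw [hl1]; exact one_pos)
  have hJ1 := norm_of_eq_I_or_neg_I hJ
  have hJ0 : J ≠ 0 := norm_pos_iff.1 (by rw [hJ1]; exact one_pos)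
  obtain ⟨κ, hκ, hdist⟩ := exists_norm_sub_ge_of_diophantine hl
  set v : ℕ → B r := fun n => residue (n + 1) • monomial r n with hv
  set p : ℕ → ℂ → ℂ := fun n q =>
    ∑ Λ ∈ rootsIn S (n + 1), Λ * ∑ i ∈ Finset.range n, q ^ i * Λ ^ (n - 1 - i) with hp
  obtain ⟨a, ha⟩ := hasGevreyExpansionOn_poles (σ := 2) (l := l)
    (isOpen_cardioid hJ0 hl0 (1 / 16)) (T := fun n => rootsIn S (n + 1)) (v := v) (C := 2)
    (c := 1 / 36) two_pos hκ (by norm_num)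
    (fun n => (Finset.card_le_card (rootsIn_subset S _)).trans (card_nthRootsFinset_le _))
    (norm_residue_smul_monomial_le' hr.le hr')
    (fun n Λ hΛ => hdist n Λ
      ((Polynomial.mem_nthRootsFinset n.succ_pos 1).1 (rootsIn_subset S _ hΛ)))
    (fun n Λ hΛ q hq => norm_sub_ge_of_mem_cardioid hJ hl1
      (norm_eq_one_of_mem_nthRootsFinset n.succ_pos (rootsIn_subset S _ hΛ))
      (hS Λ (mem_of_mem_rootsIn hΛ)) (by norm_num) (by norm_num) hq)
  have hball : ∀ q ∈ ball l (1 / 4), ‖q‖ ≤ 5 / 4 := by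
    intro q hq
    rw [mem_ball, dist_eq_norm] at hq
    have := norm_le_norm_add_norm_sub' q l
    rw [hl1] at this
    linarith
  obtain ⟨u, hu, hub⟩ : ∃ u : ℕ → ℝ, Summable u ∧ ∀ n, ∀ q ∈ ball l (1 / 4),
      ‖p n q • v n‖ ≤ u n := by
    refine ⟨_, (summable_exp_neg_div (c := 4) (by norm_num)).mul_left
      (2 * ((Real.exp (1 / 4) * 8 ^ 2 * (Nat.factorial 2)) *
      (8 ^ 0) ^ 0 * (0 * 0).factorial)), fun n q hq => ?_⟩
    rw [norm_smul]
    calc _ ≤ (((n : ℝ) + 1) ^ 2 * Real.exp ((n : ℝ) / 4)) * (2 * Real.exp (-(3 * (n : ℝ)) / 4)) :=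
          mul_le_mul (norm_holomorphic_part_le (hball q hq))
            (norm_residue_smul_monomial_le hr.le hr' n) (norm_nonneg _) (by positivity)
      _ = 2 * (((n : ℝ) + 1) ^ (0 * 0 + 2) *
          (Real.exp ((n : ℝ) / 4) * Real.exp (-(3 * (n : ℝ)) / 4))) := by ring
      _ = 2 * (((n : ℝ) + 1) ^ (0 * 0 + 2) * Real.exp (-(n : ℝ) / 2)) := by
          rw [← Real.exp_add]; congr 3; ring
      _ ≤ 2 * _ := mul_le_mul_of_nonneg_left (moment_le 0 2 0 n) (by norm_num)
      _ = _ := by ring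
  have hd2 : DifferentiableOn ℂ (fun q => ∑' n, p n q • v n) (ball l (1 / 4)) := by
    refine Complex.differentiableOn_tsum_of_summable_norm hu (fun n => ?_) isOpen_ball
      fun n q hq => hub n q hq
    refine DifferentiableOn.smul_const ?_ _
    simp only [hp]
    fun_prop
  obtain ⟨b, hb⟩ := hasGevreyExpansionOn_of_differentiableOn 2 (by norm_num) hd2
  -- The cardioid stays within `4 (1/16)^2 = 1/64` of its cusp.
  have hsub : cardioid J l (1 / 16) ⊆ ball l (1 / 4 / 4) := by
    intro q hq
    rw [mem_ball, dist_eq_norm]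
    refine (norm_sub_le_of_mem_cardioid hJ1 hl1 hq).trans_lt ?_
    norm_num
  have hsum := ha.add (by positivity) (hb.mono hsub)
  refine ⟨_, ⟨1 / 16, by norm_num, _, by rw [mul_one, ← Nat.cast_ofNat]; exact hsum⟩, 1 / 16,
    by constructor <;> norm_num, fun q hq n => ?_⟩
  have hq1 := norm_ne_one_of_mem_tangentDisks (by norm_num) hl1 hq.1
  rcases n with _ | n
  · rw [coeff_zero_right, coeff_zero_right, zero_mul]
  have s1 : Summable fun n => (∑ Λ ∈ rootsIn S (n + 1), (q - Λ)⁻¹) • v n :=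
    summable_poles_smul (fun n => rootsIn_subset S (n + 1))
      (norm_residue_smul_monomial_le' hr.le hr') hq1
  have s2 : Summable fun n => p n q • v n :=
    hu.of_norm_bounded fun n => hub n q (ball_subset_ball (by norm_num) (hsub hq.2))
  have s3 := s1.add s2
  rw [← s1.tsum_add s2]
  simp only [hv, smul_smul, ← add_smul] at s3 ⊢
  rw [coeff_tsum_smul_monomial hr s3, coeff_poleSeries hr hr' hq1,
    sum_poles_nthRootsFinset n (pow_ne_one_of_norm_ne_one hq1 n.succ_pos), deltaCoeff_eq hq1,
    ← add_mul, hp, ← Finset.sum_add_distrib]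
  have e : ∀ Λ ∈ rootsIn S (n + 1),
      (q - Λ)⁻¹ + Λ * ∑ i ∈ Finset.range n, q ^ i * Λ ^ (n - 1 - i) =
      q ^ n / (q ^ (n + 1) - 1) * (Λ * (q ^ (n + 1) - 1) * (q - Λ)⁻¹) := by
    intro Λ hΛ
    have hΛ' := rootsIn_subset S _ hΛ
    rw [← mul_pow_mul_inv_sub_eq ((Polynomial.mem_nthRootsFinset n.succ_pos 1).1 hΛ')
      fun h : q = Λ => hq1 (h ▸ norm_eq_one_of_mem_nthRootsFinset n.succ_pos hΛ')]
    have : q ^ (n + 1) - 1 ≠ 0 := sub_ne_zero.2 (pow_ne_one_of_norm_ne_one hq1 n.succ_pos)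
    field_simp
  rw [Finset.sum_congr rfl e, ← Finset.mul_sum]
  have hn : (n : ℂ) + 1 ≠ 0 := by exact_mod_cast n.succ_ne_zero
  field_simp

theorem poleSeries_mem_hadamardGevreyClass {l : ℂ} (hl : l ∈ diophantinePoints 2) {r : ℝ}
    (hr : 0 < r) (hr' : r ≤ Real.exp (1 / 4)) : poleSeries r ∈ hadamardGevreyClass 1 l r := by
  have hl1 := norm_eq_one_of_mem_diophantinePoints hl
  obtain ⟨h, hh, hcoeff⟩ := exists_hadamard_extension hl (Or.inl rfl)
    (fun Λ hΛ => re_nonpos_of_mem_arcLT hl1 hΛ) hr hr'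
  obtain ⟨k, hk, kcoeff⟩ := exists_hadamard_extension hl (Or.inr rfl)
    (fun Λ hΛ => re_nonpos_of_mem_arcGT hl1 hΛ) hr hr'
  simp only [← cardioidGT_eq] at hk kcoeff
  exact ⟨poleSeries_mem_gevreyClass hr.le hr' hl, ⟨h, hh, hcoeff⟩, ⟨k, hk, kcoeff⟩⟩

/-- The function `g` whose Taylor coefficients are given by Möbius inversion. -/
def moebiusFunction (r : ℝ) : B r :=
  ∑' n : ℕ, (((n : ℂ) + 1) * residue (n + 1)) • monomial r n

theorem coeff_moebiusFunction {r : ℝ} (hr : 0 < r) (hr' : r ≤ Real.exp (1 / 4)) (n : ℕ) :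
    coeff (moebiusFunction r) (n + 1) = ((n : ℂ) + 1) * residue (n + 1) := by
  refine coeff_tsum_smul_monomial hr ?_ n
  refine ((summable_exp_neg_div (c := 4) (by norm_num)).mul_left
    (2 * ((Real.exp (1 / 4) * 8 ^ 1 * (Nat.factorial 1)) *
      (8 ^ 0) ^ 0 * (0 * 0).factorial))).of_norm_bounded fun n => ?_
  rw [mul_smul, norm_smul]
  have hn : ‖(n : ℂ) + 1‖ = (n : ℝ) + 1 := by
    rw [← Nat.cast_succ, Complex.norm_natCast, Nat.cast_succ]
  rw [hn]
  calc _ ≤ ((n : ℝ) + 1) * (2 * Real.exp (-(n : ℝ) / 2)) := by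
        gcongr
        exact norm_residue_smul_monomial_le' hr.le hr' n
    _ = 2 * (((n : ℝ) + 1) ^ (0 * 0 + 1) * Real.exp (-(n : ℝ) / 2)) := by ring
    _ ≤ 2 * _ := mul_le_mul_of_nonneg_left (moment_le 0 1 0 n) (by norm_num)
    _ = _ := by ring

theorem chi_moebiusFunction {r : ℝ} (hr : 0 < r) (hr' : r ≤ Real.exp (1 / 4)) {q z : ℂ}
    (hq : ‖q‖ ≠ 1) (hz : z ∈ ball (0 : ℂ) r) :
    chi (moebiusFunction r) q z = ∑' n : ℕ,
      residue (n + 1) * (∑ Λ ∈ Polynomial.nthRootsFinset (n + 1) (1 : ℂ), (q - Λ)⁻¹) *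
        z ^ (n + 1) := by
  rw [chi_eq_tsum _ hz hq]
  refine tsum_congr fun n => ?_
  rw [coeff_moebiusFunction hr hr',
    sum_poles_nthRootsFinset n (pow_ne_one_of_norm_ne_one hq n.succ_pos)]
  ring

end Gammel

end

/-! ### Gammel's series as a value of the regularised solution -/

theorem theorem5p1 :
    ∃ r : ℝ, 1 < r ∧ ∃ g : Gammel.B r,
      -- the coefficients of `g` are given by Möbius inversion
      (∀ n : ℕ, 1 ≤ n →
        HasSum (fun j : ℕ => (n : ℂ) * ((ArithmeticFunction.moebius j : ℤ) : ℂ) *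
          Gammel.gammelCoeff (n * j)) (Gammel.coeff g n)) ∧
      -- `χ(q, 1) = G(q)` inside and outside the unit disk
      (∀ q : ℂ, ‖q‖ ≠ 1 → Gammel.chi g q 1 = Gammel.gammelSeries q) ∧
      -- resonances
      (∀ Λ₀ ∈ Gammel.rootsOfUnitySet,
        Gammel.gammelSeries ∈ Gammel.poleGevreyClass 1 Λ₀ ℂ ∧
        Gammel.IsQuasianalyticAt Λ₀ 1 (Gammel.poleGevreyClass 1 Λ₀ ℂ)) ∧
      -- constant-type points
      (∀ r' ∈ Set.Ioo 1 r,
        ∃ X : ℂ → Gammel.B r',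
          (∀ q : ℂ, ‖q‖ ≠ 1 → ∀ z : Metric.ball (0 : ℂ) r',
            (X q : BoundedContinuousFunction (Metric.ball (0 : ℂ) r') ℂ) z
              = Gammel.chi g q (z : ℂ)) ∧
          ∀ l ∈ Gammel.diophantinePoints 2,
            X ∈ Gammel.hadamardGevreyClass 1 l r' ∧
            Gammel.IsQuasianalyticAt l 0 (Gammel.hadamardGevreyClass 1 l r')) := by
  have hr1 : 1 < Real.exp (1 / 4) := Real.one_lt_exp_iff.2 (by norm_num)
  have hr0 : 0 < Real.exp (1 / 4) := Real.exp_pos _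
  -- The radius `e^(1/4)` exceeds `1`, so `z = 1` is admissible, and is small enough for all the
  -- weight estimates.
  refine ⟨Real.exp (1 / 4), hr1, Gammel.moebiusFunction _, fun n hn => ?_, fun q hq => ?_,
    fun Λ₀ hΛ₀ => ?_, fun r' hr' => ?_⟩
  · obtain ⟨n, rfl⟩ := Nat.exists_eq_add_of_le' hn
    rw [Gammel.coeff_moebiusFunction hr0 le_rfl, ← Nat.cast_succ]
    simp only [mul_assoc]
    exact (Gammel.summable_residue n.succ_pos).hasSum.mul_left _
  · have h1 : (1 : ℂ) ∈ Metric.ball (0 : ℂ) (Real.exp (1 / 4)) := by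
      rw [mem_ball_zero_iff, norm_one]; exact hr1
    rw [Gammel.chi_moebiusFunction hr0 le_rfl hq h1,
      ← Gammel.tsum_residue_poles_eq_gammelSeries hq]
    simp only [one_pow, mul_one]
  · refine ⟨Gammel.gammelSeries_mem_poleGevreyClass hΛ₀,
      Gammel.isQuasianalyticAt_poleGevreyClass ?_⟩
    obtain ⟨m, hm, hm1⟩ := hΛ₀
    exact Complex.norm_eq_one_of_pow_eq_one hm1 (by omega)
  · have h0 : 0 < r' := one_pos.trans hr'.1
    refine ⟨Gammel.poleSeries r', fun q hq z => ?_, fun l hl =>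
      ⟨Gammel.poleSeries_mem_hadamardGevreyClass hl h0 hr'.2.le,
        Gammel.isQuasianalyticAt_hadamardGevreyClass hl h0⟩⟩
    rw [Gammel.poleSeries_apply h0.le hr'.2.le hq,
      Gammel.chi_moebiusFunction hr0 le_rfl hq (ball_subset_ball hr'.2.le z.2)]
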